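/- For an integer $n\ge 1$ and $z\in\mathbb C$ let $$F_{2n}(z)=\int_{-\infty}^{\infty}e^{-t^{2n}}e^{izt}\,dt ,$$ and for integers $m\ge 0$ and real $w$ let $$A_{2m,2n}(w)=\iint_{\mathbb R^2}t^{2m}\exp\!\Big(-\big(\tfrac{t+X}{2}\big)^{2n}-\big(\tfrac{t-X}{2}\big)^{2n}+iwX\Big)\,dt\,dX .$$ Write $z=w-i\sigma$ with $w,\sigma$ real, and $F_{2n}(w-i\sigma)=R(\sigma,w)+iI(\sigma,w)$ with $R,I$ real. Then for every $n\ge1$ these integrals converge absolutely and the following hold. 1. For all real $\sigma,w$, $$|F_{2n}(w-i\sigma)|^2=\frac12\sum_{m\ge0}\frac{\sigma^{2m}}{(2m)!}A_{2m,2n}(w),$$ the series being convergent. 2. For each fixed real $w$, $\sigma\mapsto|F_{2n}(w-i\sigma)|^2$ is strictly increasing on $[0,\infty)$. 3. If $n\ge2$, there are a constant $c>0$ and a sequence $(\alpha_r)_{r\ge1}$ of positive reals whose set of values is exactly the set of positive real zeros of $F_{2n}$, such that for all $z\in\mathbb C$ and all real $\sigma,w$ $$F_{2n}(z)=c\prod_{r\ge1}\Big(1-\frac{z^2}{\alpha_r^2}\Big),\qquad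 |F_{2n}(w-i\sigma)|^2=c^2\prod_{r\ge1}p_r(\sigma,w),\qquad p_r(\sigma,w)=\Big|1-\frac{(w-i\sigma)^2}{\alpha_r^2}\Big|^2,$$ with both products unconditionally convergent; and for each $r$ and each fixed real $w$, $\sigma\mapsto p_r(\sigma,w)$ is strictly increasing on $[0,\infty)$. 4. Every complex zero of $F_{2n}$ is real. 5. Fix $\sigma>0$, a mass $\mu>0$ and a speed $v>0$, and let $\mathbf r(t)=(R(\sigma,vt),I(\sigma,vt),0)$. Then $\mathbf r$ is differentiable and at every time $t\in\mathbb R$ the angular momentum $\mu\,\mathbf r(t)\times\mathbf r'(t)$ has the form $(0,0,j)$ with $j>0$; that is, $\mu\big(R\,\tfrac{dI}{dt}-I\,\tfrac{dR}{dt}\big)>0$. -/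

import Mathlib

open Complex MeasureTheory
open scoped Nat Matrix

noncomputable section

namespace ExpFourier

/-- The complex Fourier transform `F_k(z) = ∫ exp(-t^k) exp(i z t) dt` over the real line. -/
def F (k : ℕ) (z : ℂ) : ℂ :=
  ∫ t : ℝ, cexp (-(t : ℂ) ^ k) * cexp (I * z * t)

/-- The point `z = w - iσ` of the complex plane. -/
def pt (σ w : ℝ) : ℂ := (w : ℂ) - I * (σ : ℂ)

/-- The real part `R(σ, w)` of `F_k(w - iσ)`. -/
def R (k : ℕ) (σ w : ℝ) : ℝ := (F k (pt σ w)).re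

/-- The imaginary part `I(σ, w)` of `F_k(w - iσ)`. -/
def J (k : ℕ) (σ w : ℝ) : ℝ := (F k (pt σ w)).im

/-- The integrand of `A_{j,k}(w)`, as a function of the pair `p = (t, X)`. -/
def integrandA (j k : ℕ) (w : ℝ) (p : ℝ × ℝ) : ℂ :=
  (p.1 : ℂ) ^ j *
    cexp (-((((p.1 : ℂ) + p.2) / 2) ^ k + (((p.1 : ℂ) - p.2) / 2) ^ k) + I * w * p.2)

/-- `A_{j,k}(w) = ∬ t^j exp(-(((t+X)/2)^k + ((t-X)/2)^k) + i w X) dt dX` over the plane. -/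
def A (j k : ℕ) (w : ℝ) : ℂ := ∫ p : ℝ × ℝ, integrandA j k w p

/-- The factor `(1 - z²/α²)(1 - conj(z)²/α²) = |1 - z²/α²|²` at `z = w - iσ`. -/
def factor (α σ w : ℝ) : ℝ := ‖1 - (pt σ w) ^ 2 / (α : ℂ) ^ 2‖ ^ 2

/-- The position at time `t` of a particle moving in the `(R, I)` plane, placed in `ℝ³`,
when `σ` is fixed and `w = v t`. -/
def orbit (k : ℕ) (σ v t : ℝ) : Fin 3 → ℝ := ![R k σ (v * t), J k σ (v * t), 0]

/-- The angular momentum `μ r × r'` about the origin of a particle of mass `μ` with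
position `r`. -/
def angularMomentum (μ : ℝ) (r : ℝ → Fin 3 → ℝ) (t : ℝ) : Fin 3 → ℝ :=
  μ • (r t ⨯₃ deriv r t)

end ExpFourier

end

/-! Everything except the series in `σ` comes from one factorisation, F(z) = F(0) exp(-γ z²) ∏ (1 -
l_i z²) with γ ≥ 0, l_i ≥ 0, ∑ l_i < ∞ and γ + ∑ l_i > 0 (`exists_F_eq_expProd`).

As a power series in x = -z², F has coefficients proportional to Γ((k+1/2)/n)/(2k)!. By duplication
this is, up to a constant, 4^(-k)/k! times Γ((k+1/2)/n)/Γ(k+1/2), and Euler's limit for Γ turns the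
last quotient into a limit of products of factors k + 1/2 + i. Multiplying the k-th coefficient by k
+ a is the operator a + x d/dx, which keeps all roots negative. Starting from (1 + cx)^N, whose
binomial coefficients supply 1/k!, F(z)/F(0) becomes a coefficientwise limit of polynomials with
negative roots. A compactness argument (`exists_tsum_eq_exp_mul_tprod`) gives such limits the
Laguerre–Pólya form above.

On z = w - iσ each squared modulus |1 - l_i z²|² is an even polynomial in σ whose σ² and σ⁴
coefficients are nonnegative, which gives monotonicity and real zeros. The angular momentum is a
positive multiple of ∂|F|²/∂σ. For n ≥ 2 growth on the imaginary axis excludes γ > 0 and forces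
every l_i > 0. The series in σ is independent of this: write F times its conjugate as a double
integral and expand exp(σ(s+u)). -/

open Polynomial in
/-- All complex roots of `p` are negative real numbers. -/
def Polynomial.NegRooted (p : ℂ[X]) : Prop :=
  ∀ z : ℂ, p.eval z = 0 → z.im = 0 ∧ z.re < 0

/-! ### Polynomials with negative roots: stability and factorisation. -/

namespace Polynomial.NegRooted

open Polynomial Filter Topology

variable {p : ℂ[X]}

lemma const_mul (hp : p.NegRooted) {c : ℂ} (hc : c ≠ 0) : (C c * p).NegRooted := by
  intro z hz
  rw [eval_mul, eval_C] at hz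
  exact hp z ((mul_eq_zero.mp hz).resolve_left hc)

lemma one_add_C_mul_X_pow {c : ℝ} (hc : 0 < c) (N : ℕ) :
    (((1 : ℂ[X]) + C (c : ℂ) * X) ^ N).NegRooted := by
  intro z hz
  simp only [eval_pow, eval_add, eval_one, eval_mul, eval_C, eval_X] at hz
  have h := eq_zero_of_pow_eq_zero hz
  have hre := congrArg Complex.re h
  have him := congrArg Complex.im h
  simp at hre him
  refine ⟨him.resolve_left hc.ne', ?_⟩
  nlinarith

/-- For real r < 0, z/(z-r) = (|z|² - rz)/|z-r|² lies in the cone spanned by 1 and z, and cones are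
closed under sums. Over the roots of p the sum is z p'(z)/p(z). -/
lemma exists_sum_div_sub_eq (z : ℂ) (m : Multiset ℂ)
    (hm : ∀ r ∈ m, r.im = 0 ∧ r.re < 0 ∧ z ≠ r) :
    ∃ U T : ℝ, 0 ≤ U ∧ 0 ≤ T ∧ (m.map fun r => z * (1 / (z - r))).sum = U + z * T := by
  induction m using Multiset.induction_on with
  | empty => exact ⟨0, 0, le_rfl, le_rfl, by simp⟩
  | cons r m ih =>
    obtain ⟨U, T, hU, hT, h⟩ := ih fun s hs => hm s (Multiset.mem_cons_of_mem hs)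
    obtain ⟨h1, h2, h3⟩ := hm r (Multiset.mem_cons_self r m)
    have hne : z - r ≠ 0 := sub_ne_zero.mpr h3
    have hpos : 0 < normSq (z - r) := normSq_pos.mpr hne
    refine ⟨normSq z / normSq (z - r) + U, -r.re / normSq (z - r) + T,
      add_nonneg (div_nonneg (normSq_nonneg _) hpos.le) hU,
      add_nonneg (div_nonneg (by linarith) hpos.le) hT, ?_⟩
    rw [Multiset.map_cons, Multiset.sum_cons, h]
    have hr : r = (r.re : ℂ) := by apply Complex.ext <;> simp [h1]
    have hconj : (starRingEnd ℂ) (z - r) = (starRingEnd ℂ) z - r := by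
      rw [map_sub, hr, conj_ofReal]
    have key : z * (1 / (z - r)) = (normSq z - r * z) / normSq (z - r) := by
      rw [← mul_conj z, ← mul_conj (z - r), hconj]
      have : (starRingEnd ℂ) z - r ≠ 0 := by
        rw [← hconj]
        exact (_root_.map_ne_zero _).mpr hne
      field_simp
    rw [key]
    push_cast
    rw [← hr]
    ring

/-- At a root z of ap + xp' with p(z) ≠ 0, dividing by p(z) gives a + U + zT = 0 with U, T ≥ 0.
Since a + U > 0, T cannot vanish and z = -(a+U)/T. -/
lemma C_mul_add_X_mul_derivative (hp : p.NegRooted) {a : ℝ} (ha : 0 < a) :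
    (C (a : ℂ) * p + X * derivative p).NegRooted := by
  intro z hz
  by_cases h0 : p.eval z = 0
  · exact hp z h0
  have hs := (IsAlgClosed.splits p).eval_derivative_div_eval_of_ne_zero h0
  obtain ⟨U, T, hU, hT, h⟩ := exists_sum_div_sub_eq z p.roots fun r hr => by
    have hr' : p.eval r = 0 := (mem_roots'.mp hr).2
    exact ⟨(hp r hr').1, (hp r hr').2, fun h => h0 (h ▸ hr')⟩
  rw [Multiset.sum_map_mul_left, ← hs] at h
  simp only [eval_add, eval_mul, eval_C, eval_X] at hz
  have h1 : (a : ℂ) + (U + z * T) = 0 := by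
    rw [← h]
    field_simp
    rw [hz, mul_zero]
  have hre := congrArg Complex.re h1
  have him := congrArg Complex.im h1
  simp at hre him
  have hT0 : T ≠ 0 := by
    rintro rfl
    linarith
  refine ⟨him.resolve_right hT0, ?_⟩
  have hT1 : 0 < T := lt_of_le_of_ne hT hT0.symm
  nlinarith

lemma exists_coeff_eq_prod_mul (hp : p.NegRooted) (I : Finset ℕ) {a : ℝ} (ha : 0 < a) :
    ∃ q : ℂ[X], q.NegRooted ∧
      ∀ k, q.coeff k = ((∏ i ∈ I, ((k : ℝ) + a + i) : ℝ) : ℂ) * p.coeff k := by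
  induction I using Finset.induction_on with
  | empty => exact ⟨p, hp, fun k => by simp⟩
  | insert i I hi ih =>
    obtain ⟨q, hq, h⟩ := ih
    refine ⟨_, hq.C_mul_add_X_mul_derivative (a := a + i) (by positivity), fun k => ?_⟩
    have hX : (X * derivative q).coeff k = k * q.coeff k := by
      cases k with
      | zero => simp
      | succ k => rw [coeff_X_mul, coeff_derivative]; push_cast; ring
    rw [coeff_add, coeff_C_mul, hX, h, Finset.prod_insert hi]
    push_cast
    ring

lemma _root_.List.prod_map_eq_prod_range_getD {M : Type*} [CommMonoid M] (f : ℝ → M)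
    (l : List ℝ) : (l.map f).prod = ∏ i ∈ Finset.range l.length, f (l.getD i 0) := by
  induction l with
  | nil => simp
  | cons a l ih =>
    rw [List.map_cons, List.prod_cons, ih, List.length_cons, Finset.prod_range_succ', mul_comm]
    simp

lemma exists_prod_X_sub_C_eq (m : Multiset ℂ) (hm : ∀ r ∈ m, r.im = 0 ∧ r ≠ 0) :
    ∃ c : ℂ, (m.map fun r => X - C r).prod = C c * (m.map ((Polynomial.map (algebraMap ℝ ℂ)) ∘
      (fun x => (1 : ℝ[X]) + C x * X) ∘ fun r => (-r⁻¹).re)).prod := by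
  induction m using Multiset.induction_on with
  | empty => exact ⟨1, by simp⟩
  | cons r m ih =>
    obtain ⟨c, hc⟩ := ih fun s hs => hm s (Multiset.mem_cons_of_mem hs)
    obtain ⟨h1, h2⟩ := hm r (Multiset.mem_cons_self r m)
    have hcast : ((-r⁻¹).re : ℂ) = -r⁻¹ := by
      apply Complex.ext <;> simp [h1]
    have hr : (X - C r : ℂ[X]) = C (-r) * (1 + C (-r⁻¹) * X) := by
      rw [mul_add, ← mul_assoc, ← C_mul, neg_mul_neg, mul_inv_cancel₀ h2]
      simp
      ring
    refine ⟨-r * c, ?_⟩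
    rw [Multiset.map_cons, Multiset.prod_cons, hc, Multiset.map_cons, Multiset.prod_cons, hr]
    simp only [Function.comp_apply, Polynomial.map_add, Polynomial.map_one, Polynomial.map_mul,
      Polynomial.map_C, Polynomial.map_X, Complex.coe_algebraMap, hcast]
    rw [C_mul]
    ring

/-- The numbers l i are the -1/r over the roots r, sorted decreasingly and padded by zeros. The
padding puts polynomials of all degrees in one sequence space; the sorting later gives a bound of
order 1/i. -/
lemma exists_eq_prod (hp : p.NegRooted) (h0 : p.coeff 0 = 1) :
    ∃ (d : ℕ) (l : ℕ → ℝ), Antitone l ∧ (∀ i, 0 ≤ l i) ∧ (∀ i, d ≤ i → l i = 0) ∧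
      p = (∏ i ∈ Finset.range d, ((1 : ℝ[X]) + C (l i) * X)).map (algebraMap ℝ ℂ) := by
  set m : Multiset ℝ := p.roots.map fun r => (-r⁻¹).re with hm
  set s : List ℝ := m.sort (· ≥ ·) with hs
  have hroot : ∀ r ∈ p.roots, r.im = 0 ∧ r.re < 0 := fun r hr => hp r (mem_roots'.mp hr).2
  have hmem : ∀ x ∈ s, 0 ≤ x := by
    intro x hx
    rw [hs, Multiset.mem_sort, hm, Multiset.mem_map] at hx
    obtain ⟨r, hr, rfl⟩ := hx
    rw [neg_re, inv_re, neg_div']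
    exact div_nonneg (by linarith [(hroot r hr).2]) (normSq_nonneg _)
  have hnn : ∀ i, 0 ≤ s.getD i 0 := by
    intro i
    by_cases hi : i < s.length
    · rw [List.getD_eq_getElem _ _ hi]
      exact hmem _ (List.getElem_mem hi)
    · rw [List.getD_eq_default _ _ (not_lt.mp hi)]
  have hsorted : s.Pairwise (· ≥ ·) := Multiset.pairwise_sort _ _
  refine ⟨s.length, fun i => s.getD i 0, ?_, hnn, ?_, ?_⟩
  · intro i j hij
    by_cases hj : j < s.length
    · have hi : i < s.length := lt_of_le_of_lt hij hj
      simp only [List.getD_eq_getElem _ _ hi, List.getD_eq_getElem _ _ hj]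
      rcases hij.eq_or_lt with rfl | hlt
      · exact le_rfl
      · exact List.pairwise_iff_getElem.mp hsorted i j hi hj hlt
    · simp only [List.getD_eq_default _ _ (not_lt.mp hj)]
      exact hnn i
  · intro i hi
    exact List.getD_eq_default _ _ hi
  · rw [← List.prod_map_eq_prod_range_getD (fun x => (1 : ℝ[X]) + C x * X)]
    have e1 : (s.map fun x => (1 : ℝ[X]) + C x * X).prod
        = (m.map fun x => (1 : ℝ[X]) + C x * X).prod := by
      rw [← Multiset.prod_coe, ← Multiset.map_coe, hs, Multiset.sort_eq]
    rw [e1, hm, Multiset.map_map, Polynomial.map_multiset_prod, Multiset.map_map]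
    obtain ⟨c, hc⟩ : ∃ c : ℂ, (p.roots.map fun r => X - C r).prod
        = C c * (p.roots.map ((Polynomial.map (algebraMap ℝ ℂ)) ∘
            (fun x => (1 : ℝ[X]) + C x * X) ∘ fun r => (-r⁻¹).re)).prod := by
      refine exists_prod_X_sub_C_eq _ fun r hr => ⟨(hroot r hr).1, fun h => ?_⟩
      have := (hroot r hr).2
      simp [h] at this
    have e3 := (IsAlgClosed.splits p).eq_prod_roots
    rw [hc, ← mul_assoc, ← C_mul] at e3
    have e4 : (p.roots.map ((Polynomial.map (algebraMap ℝ ℂ)) ∘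
            (fun x => (1 : ℝ[X]) + C x * X) ∘ fun r => (-r⁻¹).re)).prod.coeff 0 = 1 := by
      rw [coeff_zero_eq_eval_zero, eval_multiset_prod, Multiset.map_map]
      exact Multiset.prod_eq_one fun x hx => by
        obtain ⟨r, -, rfl⟩ := Multiset.mem_map.mp hx
        simp
    -- Comparing constant terms shows that the collected scalar is 1.
    have e5 := congrArg (fun q : ℂ[X] => q.coeff 0) e3
    simp only [coeff_C_mul, e4, h0, mul_one] at e5
    rw [← e5, C_1, one_mul] at e3
    exact e3

end Polynomial.NegRooted

/-! ### Coefficientwise limits of products ∏ (1 + l_i x). -/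

namespace Polynomial

open Filter Topology

lemma coeff_prod_one_add_C_mul_X_nonneg {l : ℕ → ℝ} (hl : ∀ i, 0 ≤ l i) (s : Finset ℕ) (k : ℕ) :
    0 ≤ (∏ i ∈ s, ((1 : ℝ[X]) + C (l i) * X)).coeff k := by
  induction s using Finset.induction_on generalizing k with
  | empty => rw [Finset.prod_empty, coeff_one]; split_ifs <;> norm_num
  | insert i s hi ih =>
    rw [Finset.prod_insert hi, add_mul, one_mul, mul_assoc, coeff_add, coeff_C_mul]
    refine add_nonneg (ih k) (mul_nonneg (hl i) ?_)
    cases k with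
    | zero => simp
    | succ k => rw [coeff_X_mul]; exact ih k

lemma coeff_zero_prod_one_add_C_mul_X (l : ℕ → ℝ) (s : Finset ℕ) :
    (∏ i ∈ s, ((1 : ℝ[X]) + C (l i) * X)).coeff 0 = 1 := by
  simp [coeff_zero_eq_eval_zero, eval_prod]

lemma coeff_one_prod_one_add_C_mul_X (l : ℕ → ℝ) (s : Finset ℕ) :
    (∏ i ∈ s, ((1 : ℝ[X]) + C (l i) * X)).coeff 1 = ∑ i ∈ s, l i := by
  induction s using Finset.induction_on with
  | empty => simp [coeff_one]
  | insert i s hi ih =>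
    rw [Finset.prod_insert hi, Finset.sum_insert hi, add_mul, one_mul, mul_assoc, coeff_add,
      coeff_C_mul, coeff_X_mul, ih, coeff_zero_prod_one_add_C_mul_X]
    ring

/-- With nonnegative coefficients a single term is at most the value at r, and 1 + y ≤ exp y. This
is the uniform bound for passing to the limit in the power series. -/
lemma coeff_prod_one_add_C_mul_X_mul_pow_le {l : ℕ → ℝ} (hl : ∀ i, 0 ≤ l i) (s : Finset ℕ)
    (k : ℕ) {r : ℝ} (hr : 0 ≤ r) :
    (∏ i ∈ s, ((1 : ℝ[X]) + C (l i) * X)).coeff k * r ^ k ≤ Real.exp ((∑ i ∈ s, l i) * r) := by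
  set q := ∏ i ∈ s, ((1 : ℝ[X]) + C (l i) * X) with hq
  have hterm : ∀ k, 0 ≤ q.coeff k * r ^ k := fun k =>
    mul_nonneg (coeff_prod_one_add_C_mul_X_nonneg hl s k) (pow_nonneg hr k)
  calc q.coeff k * r ^ k ≤ q.eval r := by
        rw [eval_eq_sum_range]
        by_cases hk : k ≤ q.natDegree
        · exact Finset.single_le_sum (f := fun k => q.coeff k * r ^ k) (fun i _ => hterm i)
            (Finset.mem_range.mpr (Nat.lt_succ_of_le hk))
        · rw [coeff_eq_zero_of_natDegree_lt (not_le.mp hk), zero_mul]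
          exact Finset.sum_nonneg fun i _ => hterm i
    _ = ∏ i ∈ s, (1 + l i * r) := by simp [hq, eval_prod]
    _ ≤ ∏ i ∈ s, Real.exp (l i * r) := Finset.prod_le_prod
        (fun i _ => add_nonneg zero_le_one (mul_nonneg (hl i) hr))
        fun i _ => by rw [add_comm]; exact Real.add_one_le_exp _
    _ = Real.exp ((∑ i ∈ s, l i) * r) := by rw [← Real.exp_sum, Finset.sum_mul]

end Polynomial

namespace Complex

/-- The exponential cancels the linear term, leaving a quadratic error. This makes the products
dominated when the only uniform bound is l_i ≤ B/(i+1), which is not summable but is square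
summable. -/
lemma norm_one_add_mul_exp_neg_sub_one_le {y : ℂ} {Y : ℝ} (hy : ‖y‖ ≤ Y) :
    ‖(1 + y) * exp (-y) - 1‖ ≤ ((1 + Y) * Real.exp Y + 1) * ‖y‖ ^ 2 := by
  have h := Complex.norm_exp_sub_sum_le_norm_mul_exp (-y) 2
  simp only [Finset.sum_range_succ, Finset.sum_range_zero, pow_zero, pow_one, zero_add,
    Nat.factorial, Nat.cast_one, div_one, norm_neg, mul_one] at h
  have hY : (0 : ℝ) ≤ Y := (norm_nonneg y).trans hy
  have e : (1 + y) * exp (-y) - 1 = (1 + y) * (exp (-y) - (1 + -y)) - y ^ 2 := by ring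
  rw [e]
  calc ‖(1 + y) * (exp (-y) - (1 + -y)) - y ^ 2‖
      ≤ ‖1 + y‖ * ‖exp (-y) - (1 + -y)‖ + ‖y‖ ^ 2 := by
        refine (norm_sub_le _ _).trans ?_
        rw [norm_mul, norm_pow]
    _ ≤ (1 + Y) * (‖y‖ ^ 2 * Real.exp Y) + ‖y‖ ^ 2 := by
        have h1 : ‖1 + y‖ ≤ 1 + Y := (norm_add_le _ _).trans (by simpa using hy)
        have h2 : ‖exp (-y) - (1 + -y)‖ ≤ ‖y‖ ^ 2 * Real.exp Y :=
          h.trans (by gcongr)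
        gcongr
    _ = _ := by ring

end Complex

lemma Antitone.le_div_of_sum_le {l : ℕ → ℝ} (hl : Antitone l) {B : ℝ}
    (hB : ∀ m, ∑ i ∈ Finset.range m, l i ≤ B) (i : ℕ) : l i ≤ B / (i + 1) := by
  rw [le_div_iff₀ (by positivity)]
  have h : ∑ _j ∈ Finset.range (i + 1), l i ≤ ∑ j ∈ Finset.range (i + 1), l j :=
    Finset.sum_le_sum fun j hj => hl (Nat.lt_succ_iff.mp (Finset.mem_range.mp hj))
  rw [Finset.sum_const, Finset.card_range, nsmul_eq_mul] at h
  push_cast at h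
  linarith [hB (i + 1)]

namespace Polynomial.NegRooted

open Polynomial Filter Topology

/-- A limit (coefficient by coefficient) of normalized polynomials with negative roots is
`exp (γ x) ∏ (1 + l i x)` with `γ ≥ 0` and summable `l i ≥ 0`. -/
theorem exists_tsum_eq_exp_mul_tprod {p : ℕ → ℂ[X]} (hp : ∀ N, (p N).NegRooted)
    (h0 : ∀ N, (p N).coeff 0 = 1) {b : ℕ → ℝ}
    (hb : ∀ k, Tendsto (fun N => (p N).coeff k) atTop (𝓝 (b k : ℂ))) :
    ∃ (γ : ℝ) (l : ℕ → ℝ), 0 ≤ γ ∧ Antitone l ∧ (∀ i, 0 ≤ l i) ∧ Summable l ∧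
      γ + ∑' i, l i = b 1 ∧
      ∀ x : ℂ, ∑' k, (b k : ℂ) * x ^ k = cexp (γ * x) * ∏' i, (1 + (l i : ℂ) * x) := by
  choose d L hanti hnn hzero heq using fun N => (hp N).exists_eq_prod (h0 N)
  set q : ℕ → ℝ[X] := fun N => ∏ i ∈ Finset.range (d N), ((1 : ℝ[X]) + C (L N i) * X) with hq
  set S : ℕ → ℝ := fun N => ∑ i ∈ Finset.range (d N), L N i with hS
  have hcoeff : ∀ N k, (p N).coeff k = ((q N).coeff k : ℂ) := by
    intro N k
    rw [heq N, coeff_map]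
    rfl
  have hqb : ∀ k, Tendsto (fun N => (q N).coeff k) atTop (𝓝 (b k)) := by
    intro k
    have h := (Complex.continuous_re.tendsto _).comp (hb k)
    simpa only [Function.comp_def, hcoeff, Complex.ofReal_re] using h
  have hSb : Tendsto S atTop (𝓝 (b 1)) := by
    simpa only [hq, coeff_one_prod_one_add_C_mul_X] using hqb 1
  obtain ⟨B, hB⟩ : ∃ B, ∀ N, S N ≤ B := by
    obtain ⟨B, hB⟩ := hSb.bddAbove_range
    exact ⟨B, fun N => hB ⟨N, rfl⟩⟩
  have hsum : ∀ N m, ∑ i ∈ Finset.range m, L N i ≤ S N := by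
    intro N m
    rcases le_total m (d N) with h | h
    · exact Finset.sum_le_sum_of_subset_of_nonneg (Finset.range_subset_range.mpr h)
        fun i _ _ => hnn N i
    · refine (Finset.sum_subset (Finset.range_subset_range.mpr h) fun i _ hi => ?_).ge
      exact hzero N i (not_lt.mp fun hlt => hi (Finset.mem_range.mpr hlt))
  have hdiv : ∀ N i, L N i ≤ B / (i + 1) := fun N i =>
    (hanti N).le_div_of_sum_le (fun m => (hsum N m).trans (hB N)) i
  have hB0 : 0 ≤ B := (Finset.sum_nonneg fun i _ => hnn 0 i).trans (hB 0)
  have hLB : ∀ N i, L N i ≤ B := fun N i => (hdiv N i).trans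
    (div_le_self hB0 (by linarith [(Nat.cast_nonneg i : (0 : ℝ) ≤ i)]))
  -- Compactness of [0, B]^ℕ gives convergence in each coordinate only. Mass of the sums S N may
  -- escape to infinity.
  obtain ⟨l, -, ψ, hψ, hl⟩ := (isCompact_univ_pi fun _ : ℕ => isCompact_Icc (a := (0 : ℝ)) (b := B)
    ).tendsto_subseq (x := L) fun N i _ => ⟨hnn N i, hLB N i⟩
  rw [tendsto_pi_nhds] at hl
  simp only [Function.comp_apply] at hl
  have hlnn : ∀ i, 0 ≤ l i := fun i => ge_of_tendsto' (hl i) fun N => hnn _ i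
  have hlanti : Antitone l := fun i j hij => le_of_tendsto_of_tendsto' (hl j) (hl i)
    fun N => hanti _ hij
  have hSψ : Tendsto (fun N => S (ψ N)) atTop (𝓝 (b 1)) := hSb.comp hψ.tendsto_atTop
  have hlsum : ∀ m, ∑ i ∈ Finset.range m, l i ≤ b 1 := fun m =>
    le_of_tendsto_of_tendsto' (tendsto_finsetSum _ fun i _ => hl i) hSψ fun N => hsum _ m
  have hls : Summable l := summable_of_sum_range_le hlnn hlsum
  -- The exponent γ is exactly the escaped mass.
  refine ⟨b 1 - ∑' i, l i, l, sub_nonneg.mpr (hls.tsum_le_of_sum_range_le hlsum), hlanti,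
    hlnn, hls, by ring, fun x => ?_⟩
  have hev : ∀ N, (p N).eval x = ∏ i ∈ Finset.range (d N), (1 + (L N i : ℂ) * x) := by
    intro N
    rw [heq N, Polynomial.map_prod, eval_prod]
    simp
  set E : ℂ → ℂ := fun y => (1 + y) * cexp (-y) with hE
  have hexpS : ∀ N, (p N).eval x
      = cexp (S N * x) * ∏' i, (1 + (E ((L N i : ℂ) * x) - 1)) := by
    intro N
    have h1 : ∏' i, (1 + (E ((L N i : ℂ) * x) - 1))
        = ∏ i ∈ Finset.range (d N), E ((L N i : ℂ) * x) := by
      rw [tprod_eq_prod (s := Finset.range (d N))]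
      · exact Finset.prod_congr rfl fun i _ => by ring
      · intro i hi
        rw [hzero N i (not_lt.mp fun hlt => hi (Finset.mem_range.mpr hlt))]
        simp [hE]
    rw [h1, hev, hE]
    simp only []
    rw [Finset.prod_mul_distrib, ← Complex.exp_sum, mul_left_comm, ← Complex.exp_add, hS]
    simp only [Finset.sum_neg_distrib, Complex.ofReal_sum, Finset.sum_mul]
    simp
  have hlim1 : Tendsto (fun N => (p (ψ N)).eval x) atTop
      (𝓝 (cexp ((b 1 : ℝ) * x) * ∏' i, (1 + (E ((l i : ℂ) * x) - 1)))) := by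
    simp only [hexpS]
    refine Tendsto.mul ?_ ?_
    · have hc : Continuous fun s : ℝ => cexp ((s : ℂ) * x) := by fun_prop
      exact (hc.tendsto (b 1)).comp hSψ
    · set K := (1 + B * ‖x‖) * Real.exp (B * ‖x‖) + 1 with hK
      refine tendsto_tprod_one_add_of_dominated_convergence
        (bound := fun i : ℕ => K * (B * ‖x‖) ^ 2 * (1 / ((i : ℝ) + 1) ^ 2)) ?_ ?_ ?_
      · refine Summable.mul_left _ ?_
        have h := (summable_nat_add_iff (f := fun n : ℕ => 1 / (n : ℝ) ^ 2) 1).mpr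
          (Real.summable_one_div_nat_pow.mpr one_lt_two)
        simpa using h
      · intro i
        have hc : Continuous fun s : ℝ => E ((s : ℂ) * x) - 1 := by rw [hE]; fun_prop
        exact (hc.tendsto (l i)).comp (hl i)
      · refine Eventually.of_forall fun N i => ?_
        have hnorm : ‖(L (ψ N) i : ℂ) * x‖ = L (ψ N) i * ‖x‖ := by
          rw [norm_mul, Complex.norm_real, Real.norm_of_nonneg (hnn _ _)]
        have h1 : ‖(L (ψ N) i : ℂ) * x‖ ≤ B * ‖x‖ := by
          rw [hnorm]
          exact mul_le_mul_of_nonneg_right (hLB _ _) (norm_nonneg _)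
        refine (Complex.norm_one_add_mul_exp_neg_sub_one_le h1).trans ?_
        rw [mul_assoc K]
        have hK0 : 0 ≤ K := by positivity
        refine mul_le_mul_of_nonneg_left ?_ hK0
        rw [hnorm]
        calc (L (ψ N) i * ‖x‖) ^ 2 ≤ (B / (i + 1) * ‖x‖) ^ 2 := by
              have := hdiv (ψ N) i
              have := hnn (ψ N) i
              gcongr
          _ = _ := by
              field_simp
  have hlim2 : Tendsto (fun N => (p (ψ N)).eval x) atTop (𝓝 (∑' k, (b k : ℂ) * x ^ k)) := by
    have hev2 : ∀ N, (p N).eval x = ∑' k, ((q N).coeff k : ℂ) * x ^ k := by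
      intro N
      rw [eval_eq_sum_range, tsum_eq_sum (s := Finset.range ((p N).natDegree + 1))]
      · simp only [hcoeff]
      · intro k hk
        rw [← hcoeff, coeff_eq_zero_of_natDegree_lt, zero_mul]
        simpa using hk
    simp only [hev2]
    -- Any radius larger than ‖x‖ makes the dominating series geometric with ratio below 1.
    set r : ℝ := ‖x‖ + 1 with hr
    have hr0 : 0 < r := by positivity
    refine tendsto_tsum_of_dominated_convergence
      (bound := fun k => Real.exp (B * r) * (‖x‖ / r) ^ k) ?_ ?_ ?_
    · refine Summable.mul_left _ (summable_geometric_of_lt_one (by positivity) ?_)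
      rw [div_lt_one hr0]
      linarith
    · intro k
      refine Tendsto.mul_const _ ?_
      exact (Complex.continuous_ofReal.tendsto _).comp ((hqb k).comp hψ.tendsto_atTop)
    · refine Eventually.of_forall fun N k => ?_
      have h1 := coeff_prod_one_add_C_mul_X_mul_pow_le (hnn (ψ N)) (Finset.range (d (ψ N))) k hr0.le
      have h2 : (q (ψ N)).coeff k * r ^ k ≤ Real.exp (B * r) :=
        h1.trans (Real.exp_le_exp.mpr (mul_le_mul_of_nonneg_right (hB _) hr0.le))
      rw [norm_mul, norm_pow, Complex.norm_real, Real.norm_of_nonneg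
        (coeff_prod_one_add_C_mul_X_nonneg (hnn _) _ _), div_pow, mul_div_assoc',
        le_div_iff₀ (by positivity)]
      calc _ = (q (ψ N)).coeff k * r ^ k * ‖x‖ ^ k := by ring
        _ ≤ _ := mul_le_mul_of_nonneg_right h2 (by positivity)
  rw [tendsto_nhds_unique hlim2 hlim1]
  have hsx : Summable fun i => (l i : ℂ) * x :=
    ((Complex.ofRealCLM.summable hls)).mul_right x
  have hsn : Summable fun i => ‖(l i : ℂ) * x‖ := hsx.norm
  have hm1 : HasProd (fun i => 1 + (l i : ℂ) * x) (∏' i, (1 + (l i : ℂ) * x)) :=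
    (multipliable_one_add_of_summable hsn).hasProd
  have hm2 : HasProd (fun i => cexp (-((l i : ℂ) * x))) (cexp (∑' i, -((l i : ℂ) * x))) :=
    hsx.neg.hasSum.cexp
  have hm3 := (hm1.mul hm2).tprod_eq
  have h4 : ∏' i, (1 + (E ((l i : ℂ) * x) - 1)) = ∏' i, ((1 + (l i : ℂ) * x) * cexp (-((l i : ℂ) * x))) :=
    tprod_congr fun i => by rw [hE]; ring
  rw [h4, hm3, mul_left_comm, ← Complex.exp_add, mul_comm, tsum_neg, tsum_mul_right]
  push_cast
  congr 2
  ring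

end Polynomial.NegRooted

/-! ### Quotients of Gamma values as limits of finite products. -/

namespace Real

open Filter Topology

lemma prod_range_mul_add (n N : ℕ) (hn : 0 < n) (u : ℝ) :
    ∏ i ∈ Finset.range (n * (N + 1)), (u + i)
      = (∏ i ∈ (Finset.range (n * (N + 1))).filter (fun i => ¬ n ∣ i), (u + i)) *
        ((n : ℝ) ^ (N + 1) * ∏ j ∈ Finset.range (N + 1), (u / n + j)) := by
  rw [← Finset.prod_filter_mul_prod_filter_not _ (fun i => n ∣ i), mul_comm]
  congr 1
  have h : (Finset.range (n * (N + 1))).filter (fun i => n ∣ i)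
      = (Finset.range (N + 1)).image (fun j => n * j) := by
    ext i
    simp only [Finset.mem_filter, Finset.mem_range, Finset.mem_image]
    constructor
    · rintro ⟨h1, j, rfl⟩
      exact ⟨j, Nat.lt_of_mul_lt_mul_left h1, rfl⟩
    · rintro ⟨j, h1, rfl⟩
      exact ⟨Nat.mul_lt_mul_of_pos_left h1 hn, Dvd.intro _ rfl⟩
  have hc : (n : ℝ) ^ (N + 1) = ∏ _j ∈ Finset.range (N + 1), (n : ℝ) := by simp
  rw [h, Finset.prod_image fun a _ b _ hab => Nat.eq_of_mul_eq_mul_left hn hab, hc,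
    ← Finset.prod_mul_distrib]
  refine Finset.prod_congr rfl fun j _ => ?_
  push_cast
  field_simp

/-- The second index makes its denominator run over exactly n(N+1) factors. Those with n ∣ i cancel
the N+1 factors of the first sequence, and only n ∤ i survives, in the numerator. -/
lemma GammaSeq_div_GammaSeq {n N : ℕ} (hn : 0 < n) {u : ℝ} (hu : 0 < u) :
    GammaSeq (u / n) N / GammaSeq u (n * (N + 1) - 1)
      = ((N : ℝ) ^ (u / n) / ((n * (N + 1) - 1 : ℕ) : ℝ) ^ u) *
        ((N ! : ℝ) * (n : ℝ) ^ (N + 1) / ((n * (N + 1) - 1)! : ℝ)) *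
        ∏ i ∈ (Finset.range (n * (N + 1))).filter (fun i => ¬ n ∣ i), (u + i) := by
  have h1 : n * (N + 1) - 1 + 1 = n * (N + 1) := Nat.sub_add_cancel (Nat.mul_pos hn N.succ_pos)
  have hb : ∏ j ∈ Finset.range (N + 1), (u / n + j) ≠ 0 :=
    (Finset.prod_pos fun j _ => by positivity).ne'
  have hn0 : (n : ℝ) ≠ 0 := by positivity
  unfold GammaSeq
  rw [h1, prod_range_mul_add n N hn u]
  have hM : ((n * (N + 1) - 1)! : ℝ) ≠ 0 := by positivity
  by_cases hz : ((n * (N + 1) - 1 : ℕ) : ℝ) ^ u = 0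
  · rw [hz]; simp
  · field_simp

lemma two_mul_factorial_mul_Gamma_half (k : ℕ) :
    ((2 * k)! : ℝ) * Gamma (1 / 2) = 4 ^ k * (k ! : ℝ) * Gamma (k + 1 / 2) := by
  induction k with
  | zero => simp
  | succ k ih =>
    have h : Gamma ((k + 1 : ℕ) + 1 / 2) = (k + 1 / 2) * Gamma (k + 1 / 2) := by
      rw [← Gamma_add_one (by positivity)]
      push_cast
      ring_nf
    rw [h, show 2 * (k + 1) = 2 * k + 1 + 1 by ring, Nat.factorial_succ, Nat.factorial_succ,
      Nat.factorial_succ]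
    push_cast
    linear_combination (2 * (k : ℝ) + 1 + 1) * (2 * k + 1) * ih

/-- Partial products of `Γ ((k + 1/2) / n) / Γ (k + 1/2)`, up to a factor independent of `k`. -/
lemma tendsto_prod_not_dvd {n : ℕ} (hn : 0 < n) (k : ℕ) :
    Tendsto (fun N : ℕ => ((N : ℝ) ^ (1 / n : ℝ) / ((n * (N + 1) - 1 : ℕ) : ℝ)) ^ k *
        ((∏ i ∈ (Finset.range (n * (N + 1))).filter (fun i => ¬ n ∣ i), ((k : ℝ) + 1 / 2 + i)) /
         ∏ i ∈ (Finset.range (n * (N + 1))).filter (fun i => ¬ n ∣ i), ((1 / 2 : ℝ) + i)))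
      atTop (𝓝 (Gamma ((k + 1 / 2) / n) / Gamma (k + 1 / 2) /
        (Gamma ((1 / 2) / n) / Gamma (1 / 2)))) := by
  have hM : Tendsto (fun N : ℕ => n * (N + 1) - 1) atTop atTop := by
    refine tendsto_atTop_mono (fun N => ?_) tendsto_id
    have : N + 1 ≤ n * (N + 1) := Nat.le_mul_of_pos_left _ hn
    simp only [id]
    omega
  have hn0 : (0 : ℝ) < n := by positivity
  have hlim : ∀ u : ℝ, 0 < u → Tendsto (fun N : ℕ => GammaSeq (u / n) N /
      GammaSeq u (n * (N + 1) - 1)) atTop (𝓝 (Gamma (u / n) / Gamma u)) := fun u hu =>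
    (GammaSeq_tendsto_Gamma _).div ((GammaSeq_tendsto_Gamma u).comp hM) (Gamma_pos_of_pos hu).ne'
  have h2 : (0 : ℝ) < 1 / 2 := by norm_num
  -- Dividing by the case k = 0 removes the factorials and the powers that do not depend on k.
  have h := (hlim (k + 1 / 2) (by positivity)).div (hlim (1 / 2) h2)
    (div_pos (Gamma_pos_of_pos (by positivity)) (Gamma_pos_of_pos h2)).ne'
  refine h.congr' ?_
  filter_upwards [eventually_ge_atTop 1] with N hN
  have hN0 : (0 : ℝ) < N := by exact_mod_cast hN
  have hM0 : (0 : ℝ) < ((n * (N + 1) - 1 : ℕ) : ℝ) := by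
    have : N + 1 ≤ n * (N + 1) := Nat.le_mul_of_pos_left _ hn
    exact_mod_cast (by omega : 0 < n * (N + 1) - 1)
  simp only [Pi.div_apply]
  rw [GammaSeq_div_GammaSeq hn (by positivity), GammaSeq_div_GammaSeq hn h2]
  have hP : ∏ i ∈ (Finset.range (n * (N + 1))).filter (fun i => ¬ n ∣ i), ((1 / 2 : ℝ) + i) ≠ 0 :=
    (Finset.prod_pos fun j _ => by positivity).ne'
  have e1 : (N : ℝ) ^ (((k : ℝ) + 1 / 2) / n)
      = ((N : ℝ) ^ (1 / n : ℝ)) ^ k * (N : ℝ) ^ ((1 / 2 : ℝ) / n) := by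
    rw [← rpow_natCast, ← rpow_mul hN0.le, ← rpow_add hN0]
    congr 1
    field_simp
  have e2 : ((n * (N + 1) - 1 : ℕ) : ℝ) ^ ((k : ℝ) + 1 / 2)
      = ((n * (N + 1) - 1 : ℕ) : ℝ) ^ k * ((n * (N + 1) - 1 : ℕ) : ℝ) ^ (1 / 2 : ℝ) := by
    rw [rpow_add hM0, rpow_natCast]
  rw [e1, e2, div_pow]
  generalize ((n * (N + 1) - 1 : ℕ) : ℝ) = M at *
  have e3 : (N : ℝ) ^ ((1 / 2 : ℝ) / n) ≠ 0 := (rpow_pos_of_pos hN0 _).ne'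
  have e4 : M ^ (1 / 2 : ℝ) ≠ 0 := (rpow_pos_of_pos hM0 _).ne'
  have e5 : ((n * (N + 1) - 1)! : ℝ) ≠ 0 := by positivity
  generalize (N : ℝ) ^ ((1 / 2 : ℝ) / n) = a at *
  generalize M ^ (1 / 2 : ℝ) = c at *
  generalize (N : ℝ) ^ (1 / n : ℝ) = e at *
  generalize ∏ i ∈ (Finset.range (n * (N + 1))).filter (fun i => ¬ n ∣ i), ((1 / 2 : ℝ) + i) = P at *
  have e6 : (N ! : ℝ) ≠ 0 := by positivity
  generalize (N ! : ℝ) = f at *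
  generalize ((n * (N + 1) - 1)! : ℝ) = g at *
  field_simp

end Real

/-! ### Approximating polynomials for the Gamma coefficients. -/

namespace Polynomial.NegRooted

open Polynomial Filter Topology

/-- The coefficients `Γ ((k + 1/2) / n) / (2k)!` are, up to normalization, limits of the
coefficients of polynomials with negative roots. -/
theorem exists_tendsto_coeff_Gamma {n : ℕ} (hn : 0 < n) :
    ∃ p : ℕ → ℂ[X], (∀ N, (p N).NegRooted) ∧ (∀ N, (p N).coeff 0 = 1) ∧
      ∀ k : ℕ, Tendsto (fun N => (p N).coeff k) atTop
        (𝓝 ((Real.Gamma ((k + 1 / 2) / n) / Real.Gamma ((1 / 2) / n) / ((2 * k)! : ℝ) : ℝ) : ℂ)) := by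
  set I : ℕ → Finset ℕ := fun N => (Finset.range (n * (N + 1))).filter (fun i => ¬ n ∣ i) with hI
  set ρ : ℕ → ℝ := fun N => (N : ℝ) ^ (1 / n : ℝ) / ((n * (N + 1) - 1 : ℕ) : ℝ) with hρ
  have hn0 : (0 : ℝ) < n := by positivity
  suffices h : ∀ N : ℕ, ∃ p : ℂ[X], p.NegRooted ∧ p.coeff 0 = 1 ∧ (1 ≤ N → ∀ k : ℕ,
      p.coeff k = (((N.choose k : ℝ) * (1 / N : ℝ) ^ k * (1 / 4) ^ k * (ρ N ^ k *
        ((∏ i ∈ I N, ((k : ℝ) + 1 / 2 + i)) / ∏ i ∈ I N, ((1 / 2 : ℝ) + i))) : ℝ) : ℂ)) by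
    choose p h1 h2 h3 using h
    refine ⟨p, h1, h2, fun k => ?_⟩
    have hc : Tendsto (fun N : ℕ => (N.choose k : ℝ) * (1 / N : ℝ) ^ k) atTop
        (𝓝 (1 ^ k / (k ! : ℝ))) := by
      refine ProbabilityTheory.tendsto_choose_mul_pow_atTop k ?_
      refine tendsto_const_nhds.congr' ?_
      filter_upwards [eventually_ge_atTop 1] with N hN
      have hN0 : (N : ℝ) ≠ 0 := by exact_mod_cast (by omega : N ≠ 0)
      field_simp
    have hlim := (hc.mul_const ((1 / 4 : ℝ) ^ k)).mul (Real.tendsto_prod_not_dvd hn k)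
    -- Duplication replaces (2k)! by 4^k k! Γ(k+1/2), up to Γ(1/2).
    have hval : Real.Gamma ((k + 1 / 2) / n) / Real.Gamma ((1 / 2) / n) / ((2 * k)! : ℝ)
        = 1 ^ k / (k ! : ℝ) * (1 / 4) ^ k * (Real.Gamma ((k + 1 / 2) / n) /
          Real.Gamma (k + 1 / 2) / (Real.Gamma ((1 / 2) / n) / Real.Gamma (1 / 2))) := by
      have h := Real.two_mul_factorial_mul_Gamma_half k
      have g1 : Real.Gamma (1 / 2) ≠ 0 := (Real.Gamma_pos_of_pos (by norm_num)).ne'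
      have g2 : Real.Gamma ((k : ℝ) + 1 / 2) ≠ 0 := (Real.Gamma_pos_of_pos (by positivity)).ne'
      have g3 : Real.Gamma (1 / 2 / (n : ℝ)) ≠ 0 := (Real.Gamma_pos_of_pos (by positivity)).ne'
      have g4 : ((2 * k)! : ℝ) ≠ 0 := by positivity
      have g5 : (k ! : ℝ) ≠ 0 := by positivity
      generalize Real.Gamma (((k : ℝ) + 1 / 2) / n) = x at *
      generalize Real.Gamma (1 / 2 / (n : ℝ)) = y at *
      generalize Real.Gamma ((k : ℝ) + 1 / 2) = z at *
      generalize Real.Gamma (1 / 2) = s at *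
      have hs : s = 4 ^ k * (k ! : ℝ) * z / ((2 * k)! : ℝ) := by
        rw [eq_div_iff g4, mul_comm, h]
      rw [hs, one_pow, div_pow, one_pow]
      field_simp
    rw [hval]
    refine ((Complex.continuous_ofReal.tendsto _).comp hlim).congr' ?_
    filter_upwards [eventually_ge_atTop 1] with N hN
    exact (h3 N hN k).symm
  intro N
  rcases Nat.eq_zero_or_pos N with rfl | hN
  · exact ⟨1, fun z hz => by simp at hz, by simp, fun h => by omega⟩
  have hN0 : (0 : ℝ) < N := by exact_mod_cast hN
  have hM0 : (0 : ℝ) < ((n * (N + 1) - 1 : ℕ) : ℝ) := by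
    have : N + 1 ≤ n * (N + 1) := Nat.le_mul_of_pos_left _ hn
    exact_mod_cast (by omega : 0 < n * (N + 1) - 1)
  have hρ0 : 0 < ρ N := div_pos (Real.rpow_pos_of_pos hN0 _) hM0
  -- In c, 1/N turns the binomial coefficients into 1/k!, 1/4 comes from duplication, and ρ N is the
  -- scaling in Euler's limit. The operators a + x d/dx with a = 1/2 + i supply the factors k + 1/2
  -- + i.
  obtain ⟨q, hq, hqc⟩ := (one_add_C_mul_X_pow (c := ρ N / (4 * N)) (by positivity)
    N).exists_coeff_eq_prod_mul (I N) (a := 1 / 2) (by norm_num)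
  have hP : (∏ i ∈ I N, ((1 / 2 : ℝ) + i)) ≠ 0 :=
    (Finset.prod_pos fun j _ => by positivity).ne'
  have hcoeff : ∀ k, (C (((∏ i ∈ I N, ((1 / 2 : ℝ) + i))⁻¹ : ℝ) : ℂ) * q).coeff k
      = (((N.choose k : ℝ) * (1 / N : ℝ) ^ k * (1 / 4) ^ k * (ρ N ^ k *
        ((∏ i ∈ I N, ((k : ℝ) + 1 / 2 + i)) / ∏ i ∈ I N, ((1 / 2 : ℝ) + i))) : ℝ) : ℂ) := by
    intro k
    have hbin : ((1 + C ((ρ N / (4 * N) : ℝ) : ℂ) * X : ℂ[X]) ^ N).coeff k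
        = (((ρ N / (4 * N)) ^ k * (N.choose k : ℝ) : ℝ) : ℂ) := by
      have : ((1 + C ((ρ N / (4 * N) : ℝ) : ℂ) * X : ℂ[X]) ^ N)
          = ((1 + X : ℂ[X]) ^ N).comp (C ((ρ N / (4 * N) : ℝ) : ℂ) * X) := by simp
      rw [this, comp_C_mul_X_coeff, coeff_one_add_X_pow]
      push_cast
      ring
    rw [coeff_C_mul, hqc, hbin, ← Complex.ofReal_mul, ← Complex.ofReal_mul]
    congr 1
    rw [div_pow, mul_pow, div_pow (1 : ℝ) (N : ℝ), div_pow (1 : ℝ) 4, one_pow]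
    field_simp
  refine ⟨_, hq.const_mul (c := (((∏ i ∈ I N, ((1 / 2 : ℝ) + i))⁻¹ : ℝ) : ℂ)) ?_, ?_,
    fun _ => hcoeff⟩
  · exact Complex.ofReal_ne_zero.mpr (inv_ne_zero hP)
  · rw [hcoeff]
    simp only [Nat.choose_zero_right, pow_zero, Nat.cast_zero, zero_add, Nat.cast_one, mul_one,
      div_self hP, Complex.ofReal_one]

end Polynomial.NegRooted

/-! ### Integrability and termwise expansion of exponential integrals. -/

lemma le_one_add_pow {x : ℝ} (hx : 0 ≤ x) {n : ℕ} (hn : n ≠ 0) : x ≤ 1 + x ^ n := by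
  rcases le_total x 1 with h | h
  · linarith [pow_nonneg hx n]
  · linarith [le_self_pow₀ h hn]

/-- A Gaussian dominates, by t² ≤ 1 + t^(2n) and a|t| ≤ (a² + t²)/2. -/
lemma integrable_exp_neg_pow_mul_exp_abs {n : ℕ} (hn : 1 ≤ n) (a : ℝ) :
    Integrable fun t : ℝ => Real.exp (-t ^ (2 * n)) * Real.exp (a * |t|) := by
  refine ((integrable_exp_neg_mul_sq (b := 1 / 2) (by norm_num)).const_mul
    (Real.exp (1 + a ^ 2 / 2))).mono' (by fun_prop) (ae_of_all _ fun t => ?_)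
  rw [Real.norm_of_nonneg (by positivity), ← Real.exp_add, ← Real.exp_add, Real.exp_le_exp]
  have h := le_one_add_pow (sq_nonneg t) (by omega : n ≠ 0)
  rw [← pow_mul] at h
  nlinarith [sq_nonneg (a - |t|), sq_abs t]

lemma integrable_exp_sq_sub_pow {n : ℕ} (hn : 2 ≤ n) (a : ℝ) :
    Integrable fun t : ℝ => Real.exp (-t ^ (2 * n)) * Real.exp (a * t ^ 2) := by
  refine ((integrable_exp_neg_mul_sq (b := 1) (by norm_num)).const_mul
    (Real.exp (1 + (a + 1) ^ 2))).mono' (by fun_prop) (ae_of_all _ fun t => ?_)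
  rw [Real.norm_of_nonneg (by positivity), ← Real.exp_add, ← Real.exp_add, Real.exp_le_exp]
  have h : (t ^ 2) ^ 2 ≤ 1 + (t ^ 2) ^ n := by
    rcases le_total (t ^ 2) 1 with h | h
    · have : (t ^ 2) ^ 2 ≤ 1 := pow_le_one₀ (sq_nonneg t) h
      have : 0 ≤ (t ^ 2) ^ n := by positivity
      linarith
    · linarith [pow_le_pow_right₀ h hn]
  rw [← pow_mul t 2 n] at h
  nlinarith [sq_nonneg (t ^ 2 - (a + 1)), sq_nonneg (a + 1)]

section Moments

variable {α : Type*} [MeasurableSpace α] {μ : Measure α} {g : α → ℂ} {X : α → ℝ}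

/-- Dominated convergence, the sum of the absolute values of the terms being the integrand in `h`.
It serves both F on the line and |F|² on the plane. -/
lemma hasSum_integral_mul_cexp (hg : AEStronglyMeasurable g μ) (hX : AEStronglyMeasurable X μ)
    (c : ℂ) (h : Integrable (fun a => ‖g a‖ * Real.exp (‖c‖ * |X a|)) μ) :
    HasSum (fun j : ℕ => c ^ j / (j ! : ℂ) * ∫ a, (X a : ℂ) ^ j * g a ∂μ)
      (∫ a, g a * cexp (c * X a) ∂μ) := by
  simp only [← integral_const_mul]
  have hb : ∀ a, HasSum (fun j : ℕ => ‖g a‖ * ((‖c‖ * |X a|) ^ j / (j ! : ℝ)))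
      (‖g a‖ * Real.exp (‖c‖ * |X a|)) := fun a => by
    rw [Real.exp_eq_exp_ℝ]
    exact (NormedSpace.expSeries_div_hasSum_exp (‖c‖ * |X a|)).mul_left _
  refine hasSum_integral_of_dominated_convergence
    (fun j a => ‖g a‖ * ((‖c‖ * |X a|) ^ j / (j ! : ℝ))) (fun j => ?_)
    (fun j => ae_of_all _ fun a => ?_) (ae_of_all _ fun a => (hb a).summable) ?_
    (ae_of_all _ fun a => ?_)
  · exact (((continuous_ofReal.comp_aestronglyMeasurable hX).pow j).mul hg).const_mul _
  · refine le_of_eq ?_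
    simp only [norm_mul, norm_div, norm_pow, norm_natCast, norm_real, Real.norm_eq_abs]
    ring
  · simpa only [(hb _).tsum_eq] using h
  · have h1 := (NormedSpace.expSeries_div_hasSum_exp (c * (X a : ℂ))).mul_left (g a)
    rw [← Complex.exp_eq_exp_ℂ] at h1
    refine h1.congr_fun ?_
    intro j
    ring

lemma hasSum_integral_mul_cexp_of_odd (hg : AEStronglyMeasurable g μ)
    (hX : AEStronglyMeasurable X μ)
    (c : ℂ) (h : Integrable (fun a => ‖g a‖ * Real.exp (‖c‖ * |X a|)) μ)
    (hodd : ∀ j, Odd j → ∫ a, (X a : ℂ) ^ j * g a ∂μ = 0) :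
    HasSum (fun m : ℕ => c ^ (2 * m) / ((2 * m)! : ℂ) * ∫ a, (X a : ℂ) ^ (2 * m) * g a ∂μ)
      (∫ a, g a * cexp (c * X a) ∂μ) := by
  refine ((mul_right_injective₀ (two_ne_zero (α := ℕ))).hasSum_iff fun j hj => ?_).mpr
    (hasSum_integral_mul_cexp hg hX c h)
  rw [hodd j, mul_zero]
  rw [← Nat.not_even_iff_odd]
  rintro ⟨m, rfl⟩
  exact hj ⟨m, by ring⟩

end Moments

/-! ### Power series, holomorphy and growth of F. -/

namespace ExpFourier

variable {n : ℕ}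

lemma cexp_neg_pow (t : ℝ) (k : ℕ) : cexp (-(t : ℂ) ^ k) = (Real.exp (-t ^ k) : ℂ) := by
  push_cast
  rfl

lemma norm_cexp_I_mul_le (z : ℂ) (t : ℝ) : ‖cexp (I * z * t)‖ ≤ Real.exp (‖z‖ * |t|) := by
  refine (Complex.norm_exp_le_exp_norm _).trans (le_of_eq ?_)
  simp

lemma norm_cexp_neg_pow (t : ℝ) (k : ℕ) : ‖cexp (-(t : ℂ) ^ k)‖ = Real.exp (-t ^ k) := by
  rw [cexp_neg_pow, norm_real, Real.norm_of_nonneg (Real.exp_pos _).le]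

lemma integrable_integrand (hn : 1 ≤ n) (z : ℂ) :
    Integrable fun t : ℝ => cexp (-(t : ℂ) ^ (2 * n)) * cexp (I * z * t) := by
  refine (integrable_exp_neg_pow_mul_exp_abs hn ‖z‖).mono' (by fun_prop) (ae_of_all _ fun t => ?_)
  rw [norm_mul, norm_cexp_neg_pow]
  exact mul_le_mul_of_nonneg_left (norm_cexp_I_mul_le z t) (Real.exp_pos _).le

lemma integral_even_pow_mul (hn : 1 ≤ n) (k : ℕ) :
    ∫ t : ℝ, (t : ℂ) ^ (2 * k) * cexp (-(t : ℂ) ^ (2 * n))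
      = ((1 / n * Real.Gamma ((k + 1 / 2) / n) : ℝ) : ℂ) := by
  have hn0 : (0 : ℝ) < n := by exact_mod_cast hn
  simp only [cexp_neg_pow]
  simp only [← ofReal_pow, ← ofReal_mul]
  rw [integral_complex_ofReal]
  congr 1
  have h1 : ∫ t : ℝ, t ^ (2 * k) * Real.exp (-t ^ (2 * n))
      = ∫ t : ℝ, (fun x : ℝ => x ^ (2 * k) * Real.exp (-x ^ (2 * n))) |t| := by
    congr 1 with t
    simp only [pow_mul, sq_abs]
  have h2 := integral_rpow_mul_exp_neg_rpow (p := ((2 * n : ℕ) : ℝ)) (q := ((2 * k : ℕ) : ℝ))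
    (by positivity) (by linarith [(Nat.cast_nonneg (2 * k) : (0 : ℝ) ≤ (2 * k : ℕ))])
  simp only [Real.rpow_natCast] at h2
  rw [h1, integral_comp_abs (f := fun x : ℝ => x ^ (2 * k) * Real.exp (-x ^ (2 * n))), h2]
  push_cast
  rw [show (2 * (k : ℝ) + 1) / (2 * n) = (k + 1 / 2) / n by field_simp]
  field_simp

lemma integral_odd_pow_mul (n : ℕ) {j : ℕ} (hj : Odd j) :
    ∫ t : ℝ, (t : ℂ) ^ j * cexp (-(t : ℂ) ^ (2 * n)) = 0 := by
  have h := integral_neg_eq_self (fun t : ℝ => (t : ℂ) ^ j * cexp (-(t : ℂ) ^ (2 * n))) volume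
  simp only [ofReal_neg, hj.neg_pow, (even_two_mul n).neg_pow, neg_mul, integral_neg] at h
  exact self_eq_neg.mp h.symm

/-- The power series of `F_{2n}`. -/
theorem hasSum_F (hn : 1 ≤ n) (z : ℂ) :
    HasSum (fun k : ℕ => ((1 / n * Real.Gamma ((k + 1 / 2) / n) / ((2 * k)! : ℝ) : ℝ) : ℂ) *
      (-z ^ 2) ^ k) (F (2 * n) z) := by
  have h := hasSum_integral_mul_cexp_of_odd (μ := (volume : Measure ℝ))
    (g := fun t : ℝ => cexp (-(t : ℂ) ^ (2 * n))) (X := fun t => t) (by fun_prop) (by fun_prop)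
    (I * z) (by
      simp only [norm_cexp_neg_pow]
      exact integrable_exp_neg_pow_mul_exp_abs hn _) (fun j hj => integral_odd_pow_mul n hj)
  simp only [integral_even_pow_mul hn] at h
  refine h.congr_fun ?_
  intro k
  rw [pow_mul (I * z), mul_pow, I_sq]
  push_cast
  ring

lemma differentiable_F (hn : 1 ≤ n) : Differentiable ℂ (F (2 * n)) := by
  intro z₀
  have h := hasDerivAt_integral_of_dominated_loc_of_deriv_le (μ := (volume : Measure ℝ))
    (F := fun (z : ℂ) (t : ℝ) => cexp (-(t : ℂ) ^ (2 * n)) * cexp (I * z * t))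
    (F' := fun (z : ℂ) (t : ℝ) => cexp (-(t : ℂ) ^ (2 * n)) * (cexp (I * z * t) * (I * t)))
    -- One unit covers the ball around z₀; the other absorbs the factor |t| ≤ exp |t| of the
    -- derivative.
    (bound := fun t => Real.exp (-t ^ (2 * n)) * Real.exp ((‖z₀‖ + 2) * |t|))
    (Metric.ball_mem_nhds z₀ one_pos)
    (Filter.Eventually.of_forall fun z => by fun_prop) (integrable_integrand hn z₀) (by fun_prop)
    (ae_of_all _ fun t z hz => ?_) (integrable_exp_neg_pow_mul_exp_abs hn _)
    (ae_of_all _ fun t z _ => ?_)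
  · exact h.2.differentiableAt
  · have hz' : ‖z‖ ≤ ‖z₀‖ + 1 := by
      have h1 := norm_add_le (z - z₀) z₀
      rw [sub_add_cancel] at h1
      have h2 : ‖z - z₀‖ < 1 := by rwa [← dist_eq_norm]
      linarith
    have ht : |t| ≤ Real.exp |t| := by linarith [Real.add_one_le_exp |t|]
    rw [norm_mul, norm_mul, norm_mul, norm_cexp_neg_pow, norm_I, one_mul, norm_real,
      Real.norm_eq_abs]
    refine mul_le_mul_of_nonneg_left ?_ (Real.exp_pos _).le
    calc ‖cexp (I * z * t)‖ * |t| ≤ Real.exp ((‖z₀‖ + 1) * |t|) * Real.exp |t| := by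
          refine mul_le_mul ((norm_cexp_I_mul_le z t).trans (Real.exp_le_exp.mpr ?_)) ht
            (abs_nonneg t) (Real.exp_pos _).le
          exact mul_le_mul_of_nonneg_right hz' (abs_nonneg t)
      _ = Real.exp ((‖z₀‖ + 2) * |t|) := by
          rw [← Real.exp_add]
          ring_nf
  · have h1 : HasDerivAt (fun z : ℂ => I * z * t) (I * t) z := by
      simpa using ((hasDerivAt_id z).const_mul I).mul_const (t : ℂ)
    exact h1.cexp.const_mul _

/-- From ‖z‖|t| ≤ ε‖z‖² + t²/(4ε); for n ≥ 2 the weight exp(-t^(2n)) absorbs any quadratic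
exponential. The freedom in ε later excludes a Gaussian factor. -/
lemma exists_norm_F_le (hn : 2 ≤ n) {ε : ℝ} (hε : 0 < ε) :
    ∃ K : ℝ, ∀ z : ℂ, ‖F (2 * n) z‖ ≤ K * Real.exp (ε * ‖z‖ ^ 2) := by
  refine ⟨∫ t : ℝ, Real.exp (-t ^ (2 * n)) * Real.exp (1 / (4 * ε) * t ^ 2), fun z => ?_⟩
  rw [← integral_mul_const]
  refine norm_integral_le_of_norm_le ((integrable_exp_sq_sub_pow hn _).mul_const _)
    (ae_of_all _ fun t => ?_)
  rw [norm_mul, norm_cexp_neg_pow, mul_assoc (Real.exp _)]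
  refine mul_le_mul_of_nonneg_left ((norm_cexp_I_mul_le z t).trans ?_) (Real.exp_pos _).le
  rw [← Real.exp_add, Real.exp_le_exp]
  have h : 1 / (4 * ε) * t ^ 2 + ε * ‖z‖ ^ 2 - ‖z‖ * |t|
      = ε * (‖z‖ - |t| / (2 * ε)) ^ 2 := by
    rw [← sq_abs t]
    field_simp
    ring
  nlinarith [mul_nonneg hε.le (sq_nonneg (‖z‖ - |t| / (2 * ε)))]

end ExpFourier

/-! ### The squared modulus as a double integral and its series in σ. -/

/-- The map `(s, u) ↦ (s + u, s - u)` of the plane. -/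
noncomputable def addSubEquiv : (ℝ × ℝ) ≃ₗ[ℝ] ℝ × ℝ where
  toFun p := (p.1 + p.2, p.1 - p.2)
  invFun p := ((p.1 + p.2) / 2, (p.1 - p.2) / 2)
  map_add' p q := by ext <;> simp <;> ring
  map_smul' c p := by ext <;> simp <;> ring
  left_inv p := by ext <;> simp
  right_inv p := by ext <;> simp <;> ring

@[simp]
lemma addSubEquiv_apply (p : ℝ × ℝ) : addSubEquiv p = (p.1 + p.2, p.1 - p.2) := rfl

lemma det_addSubEquiv : LinearMap.det (addSubEquiv : (ℝ × ℝ) →ₗ[ℝ] ℝ × ℝ) = -2 := by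
  rw [← LinearMap.det_toMatrix (Module.Basis.finTwoProd ℝ), Matrix.det_fin_two]
  simp [LinearMap.toMatrix_apply]
  norm_num

lemma measurableEmbedding_addSubEquiv : MeasurableEmbedding addSubEquiv :=
  addSubEquiv.toContinuousLinearEquiv.toHomeomorph.measurableEmbedding

lemma map_addSubEquiv_volume :
    Measure.map addSubEquiv volume = ENNReal.ofReal (1 / 2) • (volume : Measure (ℝ × ℝ)) := by
  have h := Measure.map_linearMap_addHaar_eq_smul_addHaar (volume : Measure (ℝ × ℝ))
    (f := (addSubEquiv : (ℝ × ℝ) →ₗ[ℝ] ℝ × ℝ)) (by rw [det_addSubEquiv]; norm_num)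
  rw [det_addSubEquiv, inv_neg, abs_neg, abs_of_pos (by norm_num), ← one_div] at h
  exact h

lemma integral_comp_addSubEquiv (f : ℝ × ℝ → ℂ) :
    ∫ p, f (addSubEquiv p) = (1 / 2 : ℂ) * ∫ p, f p := by
  rw [← measurableEmbedding_addSubEquiv.integral_map, map_addSubEquiv_volume,
    integral_smul_measure, ENNReal.toReal_ofReal (by norm_num), Complex.real_smul]
  norm_num

lemma integrable_comp_addSubEquiv {f : ℝ × ℝ → ℂ} :
    Integrable (fun p => f (addSubEquiv p)) ↔ Integrable f := by
  have h := measurableEmbedding_addSubEquiv.integrable_map_iff (μ := volume) (g := f)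
  rw [map_addSubEquiv_volume] at h
  rw [← integrable_smul_measure (μ := (volume : Measure (ℝ × ℝ))) (f := f)
    (c := ENNReal.ofReal (1 / 2)) (by simp) (by simp)]
  exact h.symm

/-- The symmetry (s, u) ↦ (-u, -s) fixes s - u and reverses s + u, so it kills the odd moments in s
+ u. -/
lemma integral_prod_neg_swap (f : ℝ × ℝ → ℂ) :
    ∫ p : ℝ × ℝ, f (-p.2, -p.1) = ∫ p, f p := by
  have h1 := integral_neg_eq_self (μ := (volume : Measure (ℝ × ℝ))) f
  have h2 := integral_prod_swap (μ := (volume : Measure ℝ)) (ν := (volume : Measure ℝ))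
    (fun p : ℝ × ℝ => f (-p))
  rw [← Measure.volume_eq_prod, h1] at h2
  rw [← h2]
  rfl

namespace ExpFourier

variable {n : ℕ}

/-- The integrand of `F(w) conj(F(w))` as a double integral. -/
noncomputable def kernel (k : ℕ) (w : ℝ) (p : ℝ × ℝ) : ℂ :=
  cexp (-(p.1 : ℂ) ^ k) * cexp (-(p.2 : ℂ) ^ k) * cexp (I * w * (p.1 - p.2))

lemma integrandA_addSubEquiv (j k : ℕ) (w : ℝ) (p : ℝ × ℝ) :
    integrandA j k w (addSubEquiv p) = ((p.1 + p.2 : ℝ) : ℂ) ^ j * kernel k w p := by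
  simp only [integrandA, addSubEquiv_apply, kernel, ← Complex.exp_add]
  congr 2
  push_cast
  ring

lemma norm_kernel (k : ℕ) (w : ℝ) (p : ℝ × ℝ) :
    ‖kernel k w p‖ = Real.exp (-p.1 ^ k) * Real.exp (-p.2 ^ k) := by
  have h : I * w * ((p.1 : ℂ) - p.2) = ((w * (p.1 - p.2) : ℝ) : ℂ) * I := by
    push_cast
    ring
  rw [kernel, norm_mul, norm_mul, norm_cexp_neg_pow, norm_cexp_neg_pow, h,
    norm_exp_ofReal_mul_I, mul_one]

lemma continuous_kernel (k : ℕ) (w : ℝ) : Continuous (kernel k w) := by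
  unfold kernel
  fun_prop

lemma integrable_norm_kernel_mul_exp (hn : 1 ≤ n) (w : ℝ) {a : ℝ} (ha : 0 ≤ a) :
    Integrable fun p : ℝ × ℝ => ‖kernel (2 * n) w p‖ * Real.exp (a * |p.1 + p.2|) := by
  refine ((integrable_exp_neg_pow_mul_exp_abs hn a).mul_prod
    (integrable_exp_neg_pow_mul_exp_abs hn a)).mono' ?_ (ae_of_all _ fun p => ?_)
  · have := continuous_kernel (2 * n) w
    exact Continuous.aestronglyMeasurable (by fun_prop)
  · rw [norm_kernel, Real.norm_of_nonneg (by positivity)]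
    have h : Real.exp (a * |p.1 + p.2|) ≤ Real.exp (a * |p.1|) * Real.exp (a * |p.2|) := by
      rw [← Real.exp_add, ← mul_add]
      exact Real.exp_le_exp.mpr (mul_le_mul_of_nonneg_left (abs_add_le _ _) ha)
    calc _ ≤ Real.exp (-p.1 ^ (2 * n)) * Real.exp (-p.2 ^ (2 * n)) *
          (Real.exp (a * |p.1|) * Real.exp (a * |p.2|)) :=
          mul_le_mul_of_nonneg_left h (by positivity)
      _ = _ := by ring

lemma integrable_integrandA (hn : 1 ≤ n) (j : ℕ) (w : ℝ) :
    Integrable (integrandA j (2 * n) w) := by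
  rw [← integrable_comp_addSubEquiv]
  simp only [integrandA_addSubEquiv]
  refine ((integrable_norm_kernel_mul_exp hn w zero_le_one).const_mul (j ! : ℝ)).mono' ?_
    (ae_of_all _ fun p => ?_)
  · have := continuous_kernel (2 * n) w
    exact Continuous.aestronglyMeasurable (by fun_prop)
  · rw [norm_mul, norm_pow, norm_real, Real.norm_eq_abs, one_mul, mul_left_comm, mul_comm]
    refine mul_le_mul_of_nonneg_left ?_ (norm_nonneg _)
    have h := Real.pow_div_factorial_le_exp _ (abs_nonneg (p.1 + p.2)) j
    rwa [div_le_iff₀ (by positivity), mul_comm] at h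

lemma A_eq (j k : ℕ) (w : ℝ) :
    (1 / 2 : ℂ) * A j k w = ∫ p : ℝ × ℝ, ((p.1 + p.2 : ℝ) : ℂ) ^ j * kernel k w p := by
  simp only [A, ← integral_comp_addSubEquiv, integrandA_addSubEquiv]

lemma kernel_neg_swap {k : ℕ} (hk : Even k) (w : ℝ) (p : ℝ × ℝ) :
    kernel k w (-p.2, -p.1) = kernel k w p := by
  simp only [kernel, ofReal_neg, hk.neg_pow]
  rw [mul_comm (cexp (-(p.2 : ℂ) ^ k))]
  congr 2
  ring

/-- In F times its conjugate the phases combine to izs - i conj(z) u = iw(s-u) + σ(s+u). -/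
lemma norm_F_sq_eq_integral (n : ℕ) (σ w : ℝ) :
    ((‖F (2 * n) (pt σ w)‖ ^ 2 : ℝ) : ℂ)
      = ∫ p : ℝ × ℝ, kernel (2 * n) w p * cexp ((σ : ℂ) * (p.1 + p.2 : ℝ)) := by
  rw [← Complex.normSq_eq_norm_sq, ← Complex.mul_conj, F, ← integral_conj, ← integral_prod_mul]
  rw [← Measure.volume_eq_prod]
  congr 1 with p
  simp only [kernel, pt, ← Complex.exp_add, ← Complex.exp_conj]
  congr 1
  simp only [map_add, map_mul, map_neg, map_pow, conj_ofReal, conj_I, map_sub]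
  push_cast
  linear_combination (-(σ : ℂ)) * (p.1 + p.2) * I_sq

theorem hasSum_norm_F_sq (hn : 1 ≤ n) (σ w : ℝ) :
    HasSum (fun m : ℕ => (1 / 2 : ℂ) *
      ((σ : ℂ) ^ (2 * m) / ((2 * m)! : ℂ) * A (2 * m) (2 * n) w))
      ((‖F (2 * n) (pt σ w)‖ ^ 2 : ℝ) : ℂ) := by
  have h := hasSum_integral_mul_cexp_of_odd (μ := (volume : Measure (ℝ × ℝ)))
    (g := kernel (2 * n) w) (X := fun p => p.1 + p.2)
    (continuous_kernel _ _).aestronglyMeasurable (by fun_prop) σ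
    (integrable_norm_kernel_mul_exp hn w (norm_nonneg _)) (fun j hj => ?_)
  · rw [← norm_F_sq_eq_integral] at h
    refine h.congr_fun fun m => ?_
    rw [← A_eq]
    ring
  · have h1 := integral_prod_neg_swap
      (fun p => ((p.1 + p.2 : ℝ) : ℂ) ^ j * kernel (2 * n) w p)
    simp only [kernel_neg_swap (even_two_mul n)] at h1
    have h2 : ∀ p : ℝ × ℝ, ((-p.2 + -p.1 : ℝ) : ℂ) ^ j * kernel (2 * n) w p
        = -(((p.1 + p.2 : ℝ) : ℂ) ^ j * kernel (2 * n) w p) := by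
      intro p
      rw [← neg_add, add_comm p.2, ofReal_neg, hj.neg_pow, neg_mul]
    simp only [h2, integral_neg] at h1
    exact self_eq_neg.mp h1.symm

end ExpFourier

/-! ### Consequences of the factorisation: monotonicity, real zeros, angular momentum. -/

lemma HasProd.le_of_nonneg_of_le {a b : ℕ → ℝ} {x y : ℝ} (ha : HasProd a x) (hb : HasProd b y)
    (h0 : ∀ i, 0 ≤ a i) (hab : ∀ i, a i ≤ b i) : x ≤ y :=
  le_of_tendsto_of_tendsto' ha hb fun _ => Finset.prod_le_prod (fun i _ => h0 i) fun i _ => hab i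

/-- If `G = h T` with `h ≥ 0` and `T` nondecreasing, then `G' ≥ h' T`. -/
lemma mul_le_of_hasDerivAt_of_monotoneOn {G h T : ℝ → ℝ} {G' h' x : ℝ} (hx : 0 ≤ x)
    (hG : ∀ s, G s = h s * T s) (h0 : ∀ s, 0 ≤ h s) (hT : MonotoneOn T (Set.Ici 0))
    (hGd : HasDerivAt G G' x) (hhd : HasDerivAt h h' x) : h' * T x ≤ G' := by
  have h1 := (hasDerivWithinAt_iff_tendsto_slope' (s := Set.Ioi x) (by simp)).mp
    hGd.hasDerivWithinAt
  have h2 := (hasDerivWithinAt_iff_tendsto_slope' (s := Set.Ioi x) (by simp)).mp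
    hhd.hasDerivWithinAt
  refine le_of_tendsto_of_tendsto (h2.mul_const (T x)) h1 ?_
  filter_upwards [self_mem_nhdsWithin] with s hs
  have hs' : 0 < s - x := sub_pos.mpr hs
  -- The difference of the numerators is h s (T s - T x) ≥ 0, so T need not be differentiable.
  rw [slope_def_field, slope_def_field, div_mul_eq_mul_div, div_le_div_iff_of_pos_right hs',
    hG s, hG x, sub_mul]
  have := mul_le_mul_of_nonneg_left
    (hT (Set.mem_Ici.mpr hx) (Set.mem_Ici.mpr (hx.trans (le_of_lt hs))) (le_of_lt hs)) (h0 s)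
  linarith

namespace ExpFourier

open Filter Topology

variable {n : ℕ}

lemma pt_neg_im_re (z : ℂ) : pt (-z.im) z.re = z := by
  apply Complex.ext <;> simp [pt]

lemma neg_pt_sq (σ w : ℝ) : -(pt σ w) ^ 2 = ((σ ^ 2 - w ^ 2 : ℝ) : ℂ) + (2 * w * σ : ℝ) * I := by
  rw [pt]
  push_cast
  linear_combination (-(σ : ℂ) ^ 2) * I_sq

/-- Expanded in powers of σ, the coefficients are nonnegative for a ≥ 0, and that of σ² is positive
for a > 0. Monotonicity and nonvanishing off the real axis both follow. -/
lemma norm_sq_one_add_mul_neg_pt_sq (a σ w : ℝ) :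
    ‖1 + (a : ℂ) * -(pt σ w) ^ 2‖ ^ 2
      = (1 - a * w ^ 2) ^ 2 + (2 * a + 2 * a ^ 2 * w ^ 2) * σ ^ 2 + a ^ 2 * σ ^ 4 := by
  have h : ∀ u v : ℝ, ‖1 + (a : ℂ) * ((u : ℂ) + (v : ℂ) * I)‖ ^ 2
      = (1 + a * u) ^ 2 + (a * v) ^ 2 := by
    intro u v
    rw [← normSq_eq_norm_sq, normSq_apply]
    simp
    ring
  rw [neg_pt_sq, h]
  ring

lemma norm_cexp_mul_neg_pt_sq (γ σ w : ℝ) :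
    ‖cexp ((γ : ℂ) * -(pt σ w) ^ 2)‖ = Real.exp (γ * (σ ^ 2 - w ^ 2)) := by
  rw [Complex.norm_exp, neg_pt_sq]
  generalize σ ^ 2 - w ^ 2 = u
  generalize 2 * w * σ = v
  simp

lemma one_add_mul_neg_pt_sq_ne_zero {a σ : ℝ} (ha : 0 ≤ a) (hσ : σ ≠ 0) (w : ℝ) :
    1 + (a : ℂ) * -(pt σ w) ^ 2 ≠ 0 := by
  intro h
  have h1 := norm_sq_one_add_mul_neg_pt_sq a σ w
  rw [h, norm_zero] at h1
  rcases ha.eq_or_lt with rfl | ha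
  · norm_num at h1
  · have h2 : 0 < (2 * a + 2 * a ^ 2 * w ^ 2) * σ ^ 2 := by positivity
    nlinarith [sq_nonneg (1 - a * w ^ 2), sq_nonneg (a * σ ^ 2)]

lemma norm_one_add_mul_neg_pt_sq_le {a : ℝ} (ha : 0 ≤ a) {σ τ : ℝ} (hσ : 0 ≤ σ) (hτ : σ ≤ τ)
    (w : ℝ) : ‖1 + (a : ℂ) * -(pt σ w) ^ 2‖ ≤ ‖1 + (a : ℂ) * -(pt τ w) ^ 2‖ := by
  rw [← sq_le_sq₀ (norm_nonneg _) (norm_nonneg _), norm_sq_one_add_mul_neg_pt_sq,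
    norm_sq_one_add_mul_neg_pt_sq]
  gcongr

/-- The function `exp (-γ z²) ∏ (1 - l i z²)`. -/
noncomputable def expProd (γ : ℝ) (l : ℕ → ℝ) (z : ℂ) : ℂ :=
  cexp (γ * -z ^ 2) * ∏' i, (1 + (l i : ℂ) * -z ^ 2)

section expProd

variable {γ : ℝ} {l : ℕ → ℝ}

lemma summable_norm_mul (hl : Summable l) (x : ℂ) : Summable fun i => ‖(l i : ℂ) * x‖ :=
  ((Complex.ofRealCLM.summable hl).mul_right x).norm

lemma hasProd_one_add (hl : Summable l) (x : ℂ) :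
    HasProd (fun i => 1 + (l i : ℂ) * x) (∏' i, (1 + (l i : ℂ) * x)) :=
  (multipliable_one_add_of_summable (summable_norm_mul hl x)).hasProd

lemma expProd_eq_zero_iff (hl : Summable l) (z : ℂ) :
    expProd γ l z = 0 ↔ ∃ i, 1 + (l i : ℂ) * -z ^ 2 = 0 := by
  rw [expProd, mul_eq_zero, or_iff_right (Complex.exp_ne_zero _)]
  constructor
  · intro h
    by_contra! hne
    exact tprod_one_add_ne_zero_of_summable hne (summable_norm_mul hl _) h
  · rintro ⟨i, hi⟩
    exact tprod_of_exists_eq_zero ⟨i, hi⟩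

lemma expProd_pt_ne_zero (hl : Summable l) (h0 : ∀ i, 0 ≤ l i) {σ : ℝ} (hσ : σ ≠ 0) (w : ℝ) :
    expProd γ l (pt σ w) ≠ 0 := by
  rw [Ne, expProd_eq_zero_iff hl]
  rintro ⟨i, hi⟩
  exact one_add_mul_neg_pt_sq_ne_zero (h0 i) hσ w hi

lemma norm_expProd_pt_le (hγ : 0 ≤ γ) (hl : Summable l) (h0 : ∀ i, 0 ≤ l i) {σ τ : ℝ}
    (hσ : 0 ≤ σ) (hτ : σ ≤ τ) (w : ℝ) :
    ‖expProd γ l (pt σ w)‖ ≤ ‖expProd γ l (pt τ w)‖ := by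
  rw [expProd, expProd, norm_mul, norm_mul, norm_cexp_mul_neg_pt_sq, norm_cexp_mul_neg_pt_sq]
  refine mul_le_mul (Real.exp_le_exp.mpr (by gcongr)) ?_ (norm_nonneg _) (Real.exp_pos _).le
  exact (hasProd_one_add hl _).norm.le_of_nonneg_of_le (hasProd_one_add hl _).norm
    (fun i => norm_nonneg _) fun i => norm_one_add_mul_neg_pt_sq_le (h0 i) hσ hτ w

lemma expProd_eq_mul_update (hl : Summable l) (z : ℂ) :
    expProd γ l z = (1 + (l 0 : ℂ) * -z ^ 2) * expProd γ (Function.update l 0 0) z := by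
  have hl' : Summable (Function.update l 0 0) := hl.update 0 0
  have h1 := (hasProd_one_add hl' (-z ^ 2)).mul
    (hasProd_ite_eq (0 : ℕ) (1 + (l 0 : ℂ) * -z ^ 2))
  have h2 : (fun i => (1 + (Function.update l 0 0 i : ℂ) * -z ^ 2) *
      (if i = 0 then 1 + (l 0 : ℂ) * -z ^ 2 else 1)) = fun i => 1 + (l i : ℂ) * -z ^ 2 := by
    funext i
    rcases eq_or_ne i 0 with rfl | hi
    · simp
    · simp [hi]
  rw [h2] at h1
  rw [expProd, expProd, h1.tprod_eq]
  ring

/-- The squared modulus on a vertical line is a function with positive derivative times a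
nondecreasing function. -/
lemma exists_norm_sq_expProd_eq_mul (hγ : 0 ≤ γ) (hl : Summable l) (h0 : ∀ i, 0 ≤ l i)
    (hanti : Antitone l) (hpos : 0 < γ + ∑' i, l i) (w : ℝ) :
    ∃ h h' T : ℝ → ℝ, (∀ σ, ‖expProd γ l (pt σ w)‖ ^ 2 = h σ * T σ) ∧ (∀ σ, 0 ≤ h σ) ∧
      (∀ σ, HasDerivAt h (h' σ) σ) ∧ (∀ σ, 0 < σ → 0 < h' σ) ∧ MonotoneOn T (Set.Ici 0) ∧
      ∀ σ, 0 < σ → 0 < T σ := by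
  have hT : ∀ (γ : ℝ) (l : ℕ → ℝ), 0 ≤ γ → Summable l → (∀ i, 0 ≤ l i) →
      MonotoneOn (fun σ => ‖expProd γ l (pt σ w)‖ ^ 2) (Set.Ici 0) ∧
      ∀ σ, 0 < σ → 0 < ‖expProd γ l (pt σ w)‖ ^ 2 := by
    intro γ l hγ hl h0
    refine ⟨fun σ hσ τ _ h => ?_, fun σ hσ => ?_⟩
    · exact pow_le_pow_left₀ (norm_nonneg _) (norm_expProd_pt_le hγ hl h0 hσ h w) 2
    · have := norm_pos_iff.mpr (expProd_pt_ne_zero (γ := γ) hl h0 hσ.ne' w)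
      positivity
  -- The largest l i decides which factor becomes h: if it vanishes, all do and γ > 0, so the
  -- Gaussian serves; otherwise the factor of index 0 does.
  rcases (h0 0).eq_or_lt with hz | hz
  · have hall : ∀ i, l i = 0 := fun i => le_antisymm ((hanti (Nat.zero_le i)).trans hz.ge) (h0 i)
    have hγ' : 0 < γ := by simpa [hall] using hpos
    obtain ⟨hT1, hT2⟩ := hT 0 l le_rfl hl h0
    refine ⟨fun σ => Real.exp (γ * (σ ^ 2 - w ^ 2)) ^ 2, fun σ =>
      2 * Real.exp (γ * (σ ^ 2 - w ^ 2)) * (Real.exp (γ * (σ ^ 2 - w ^ 2)) * (γ * (2 * σ))),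
      _, fun σ => ?_, fun σ => by positivity, fun σ => ?_, fun σ hσ => by positivity, hT1, hT2⟩
    · beta_reduce
      rw [← norm_cexp_mul_neg_pt_sq, ← mul_pow, ← norm_mul]
      simp [expProd]
    · have h1 : HasDerivAt (fun σ : ℝ => γ * (σ ^ 2 - w ^ 2)) (γ * (2 * σ)) σ := by
        simpa using ((hasDerivAt_pow 2 σ).sub_const (w ^ 2)).const_mul γ
      exact (h1.exp.pow 2).congr_deriv (by simp)
  · have h0' : ∀ i, 0 ≤ Function.update l 0 0 i := by
      intro i
      rcases eq_or_ne i 0 with rfl | hi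
      · simp
      · simpa [hi] using h0 i
    obtain ⟨hT1, hT2⟩ := hT γ _ hγ (hl.update 0 0) h0'
    set a := l 0
    refine ⟨fun σ => (1 - a * w ^ 2) ^ 2 + (2 * a + 2 * a ^ 2 * w ^ 2) * σ ^ 2 + a ^ 2 * σ ^ 4,
      fun σ => (2 * a + 2 * a ^ 2 * w ^ 2) * (2 * σ) + a ^ 2 * (4 * σ ^ 3),
      _, fun σ => ?_, fun σ => by positivity, fun σ => ?_, fun σ hσ => by positivity, hT1, hT2⟩
    · rw [expProd_eq_mul_update hl, norm_mul, mul_pow, norm_sq_one_add_mul_neg_pt_sq]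
    · have h2 := (hasDerivAt_pow 2 σ).const_mul (2 * a + 2 * a ^ 2 * w ^ 2)
      have h4 := (hasDerivAt_pow 4 σ).const_mul (a ^ 2)
      exact ((h2.const_add ((1 - a * w ^ 2) ^ 2)).add h4).congr_deriv (by simp)

end expProd

/-- The value `F_{2n}(0)`. -/
noncomputable def F₀ (n : ℕ) : ℝ := 1 / n * Real.Gamma ((1 / 2) / n)

lemma F₀_pos (hn : 1 ≤ n) : 0 < F₀ n := by
  have hn0 : (0 : ℝ) < n := by exact_mod_cast hn
  exact mul_pos (by positivity) (Real.Gamma_pos_of_pos (by positivity))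

/-- The limit theorem at x = -z². Positivity of γ + ∑ l i holds because it is the normalised first
coefficient; it excludes a constant F. -/
theorem exists_F_eq_expProd (hn : 1 ≤ n) :
    ∃ (γ : ℝ) (l : ℕ → ℝ), 0 ≤ γ ∧ Antitone l ∧ (∀ i, 0 ≤ l i) ∧ Summable l ∧
      0 < γ + ∑' i, l i ∧ ∀ z, F (2 * n) z = F₀ n * expProd γ l z := by
  have hn0 : (0 : ℝ) < n := by exact_mod_cast hn
  obtain ⟨p, h1, h2, h3⟩ := Polynomial.NegRooted.exists_tendsto_coeff_Gamma hn
  obtain ⟨γ, l, hγ, hanti, h0, hl, hsum, hev⟩ :=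
    Polynomial.NegRooted.exists_tsum_eq_exp_mul_tprod h1 h2 h3
  refine ⟨γ, l, hγ, hanti, h0, hl, ?_, fun z => ?_⟩
  · rw [hsum]
    exact div_pos (div_pos (Real.Gamma_pos_of_pos (by positivity))
      (Real.Gamma_pos_of_pos (by positivity))) (by positivity)
  · rw [expProd, ← hev, ← tsum_mul_left, ← (hasSum_F hn z).tsum_eq]
    refine tsum_congr fun k => ?_
    rw [← mul_assoc, ← ofReal_mul, F₀]
    congr 2
    have hg : Real.Gamma ((1 / 2) / n) ≠ 0 := (Real.Gamma_pos_of_pos (by positivity)).ne'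
    generalize Real.Gamma ((1 / 2) / n) = g at *
    field_simp

lemma norm_F_sq_eq {γ : ℝ} {l : ℕ → ℝ} (h : ∀ z, F (2 * n) z = F₀ n * expProd γ l z) (z : ℂ) :
    ‖F (2 * n) z‖ ^ 2 = F₀ n ^ 2 * ‖expProd γ l z‖ ^ 2 := by
  rw [h, norm_mul, mul_pow, norm_real, Real.norm_eq_abs, sq_abs]

lemma exists_norm_sq_F_eq_mul (hn : 1 ≤ n) (w : ℝ) :
    ∃ h h' T : ℝ → ℝ, (∀ σ, ‖F (2 * n) (pt σ w)‖ ^ 2 = h σ * T σ) ∧ (∀ σ, 0 ≤ h σ) ∧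
      (∀ σ, HasDerivAt h (h' σ) σ) ∧ (∀ σ, 0 < σ → 0 < h' σ) ∧ MonotoneOn T (Set.Ici 0) ∧
      ∀ σ, 0 < σ → 0 < T σ := by
  obtain ⟨γ, l, hγ, hanti, h0, hl, hpos, hF⟩ := exists_F_eq_expProd hn
  obtain ⟨h, h', T, e1, e2, e3, e4, e5, e6⟩ :=
    exists_norm_sq_expProd_eq_mul hγ hl h0 hanti hpos w
  have hc := F₀_pos hn
  refine ⟨h, h', fun σ => F₀ n ^ 2 * T σ, fun σ => ?_, e2, e3, e4, fun σ hσ τ hτ hst => ?_,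
    fun σ hσ => mul_pos (by positivity) (e6 σ hσ)⟩
  · rw [norm_F_sq_eq hF, e1]
    ring
  · exact mul_le_mul_of_nonneg_left (e5 hσ hτ hst) (by positivity)

theorem strictMonoOn_norm_sq_F (hn : 1 ≤ n) (w : ℝ) :
    StrictMonoOn (fun σ : ℝ => ‖F (2 * n) (pt σ w)‖ ^ 2) (Set.Ici 0) := by
  obtain ⟨h, h', T, e1, e2, e3, e4, e5, e6⟩ := exists_norm_sq_F_eq_mul hn w
  have hh : StrictMonoOn h (Set.Ici 0) := by
    refine strictMonoOn_of_deriv_pos (convex_Ici 0)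
      (fun σ _ => (e3 σ).continuousAt.continuousWithinAt) fun σ hσ => ?_
    rw [interior_Ici] at hσ
    rw [(e3 σ).deriv]
    exact e4 σ hσ
  intro σ hσ τ hτ hst
  simp only [e1]
  calc h σ * T σ ≤ h σ * T τ := mul_le_mul_of_nonneg_left (e5 hσ hτ hst.le) (e2 σ)
    _ < h τ * T τ := mul_lt_mul_of_pos_right (hh hσ hτ hst)
      (e6 τ (lt_of_le_of_lt hσ hst))

theorem im_eq_zero_of_F_eq_zero (hn : 1 ≤ n) {z : ℂ} (hz : F (2 * n) z = 0) : z.im = 0 := by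
  obtain ⟨γ, l, hγ, hanti, h0, hl, hpos, hF⟩ := exists_F_eq_expProd hn
  by_contra him
  rw [hF, mul_eq_zero, or_iff_right (ofReal_ne_zero.mpr (F₀_pos hn).ne')] at hz
  have := expProd_pt_ne_zero (γ := γ) hl h0 (neg_ne_zero.mpr him) z.re
  rw [pt_neg_im_re] at this
  exact this hz

/-- Since ∂z/∂σ = -i, twice this quantity is ∂|F|²/∂σ. Strict monotonicity alone would only give ≥
0; the decomposition h T gives the lower bound h' T > 0. -/
lemma zero_lt_im_conj_mul_deriv (hn : 1 ≤ n) {σ : ℝ} (hσ : 0 < σ) (w : ℝ) :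
    0 < ((starRingEnd ℂ) (F (2 * n) (pt σ w)) * deriv (F (2 * n)) (pt σ w)).im := by
  obtain ⟨h, h', T, e1, e2, e3, e4, e5, e6⟩ := exists_norm_sq_F_eq_mul hn w
  have hpt : HasDerivAt (fun σ : ℝ => pt σ w) (-I) σ := by
    have h1 : HasDerivAt (fun σ : ℝ => (σ : ℂ)) 1 σ := by
      simpa using (hasDerivAt_id σ).ofReal_comp
    simpa [pt] using (h1.const_mul I).const_sub (w : ℂ)
  have hF := ((differentiable_F hn) (pt σ w)).hasDerivAt.comp σ hpt
  have hG := hF.norm_sq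
  have hle := mul_le_of_hasDerivAt_of_monotoneOn hσ.le e1 e2 e5 hG (e3 σ)
  have hpos := mul_pos (e4 σ hσ) (e6 σ hσ)
  rw [Complex.inner] at hle
  simp at hle ⊢
  linarith

theorem angularMomentum_orbit (hn : 1 ≤ n) {σ μ v : ℝ} (hσ : 0 < σ) (hμ : 0 < μ) (hv : 0 < v) :
    Differentiable ℝ (orbit (2 * n) σ v) ∧
      ∀ t : ℝ, ∃ j : ℝ, 0 < j ∧ angularMomentum μ (orbit (2 * n) σ v) t = ![0, 0, j] := by
  have hd : ∀ t : ℝ, HasDerivAt (orbit (2 * n) σ v)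
      ![(deriv (F (2 * n)) (pt σ (v * t)) * v).re, (deriv (F (2 * n)) (pt σ (v * t)) * v).im, 0]
      t := by
    intro t
    have hpt : HasDerivAt (fun t : ℝ => pt σ (v * t)) (v : ℂ) t := by
      have h1 : HasDerivAt (fun t : ℝ => ((v * t : ℝ) : ℂ)) (v : ℂ) t := by
        simpa using ((hasDerivAt_id t).const_mul v).ofReal_comp
      exact h1.sub_const _
    have hF := ((differentiable_F hn) (pt σ (v * t))).hasDerivAt.comp t hpt
    rw [hasDerivAt_pi]
    intro i
    fin_cases i
    · exact reCLM.hasFDerivAt.comp_hasDerivAt t hF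
    · exact imCLM.hasFDerivAt.comp_hasDerivAt t hF
    · exact hasDerivAt_const t (0 : ℝ)
  refine ⟨fun t => (hd t).differentiableAt, fun t => ?_⟩
  -- By the chain rule with w = vt, R I' - I R' is v times Im(conj(F) F').
  refine ⟨μ * (v * ((starRingEnd ℂ) (F (2 * n) (pt σ (v * t))) *
    deriv (F (2 * n)) (pt σ (v * t))).im),
    mul_pos hμ (mul_pos hv (zero_lt_im_conj_mul_deriv hn hσ _)), ?_⟩
  rw [angularMomentum, (hd t).deriv, cross_apply]
  ext i
  fin_cases i
  · simp [orbit]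
  · simp [orbit]
  · simp [orbit, R, J]
    left
    ring

end ExpFourier

/-! ### The case n ≥ 2: the product over the positive zeros. -/

namespace ExpFourier

open Filter Topology

variable {n : ℕ} {γ : ℝ} {l : ℕ → ℝ}

lemma neg_pt_zero_sq (σ : ℝ) : -(pt σ 0) ^ 2 = ((σ ^ 2 : ℝ) : ℂ) := by
  rw [neg_pt_sq]
  simp

lemma norm_pt_zero (σ : ℝ) : ‖pt σ 0‖ = |σ| := by
  simp [pt]

lemma exp_le_norm_expProd (hl : Summable l) (h0 : ∀ i, 0 ≤ l i) {σ : ℝ} (hσ : 0 ≤ σ) :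
    Real.exp (γ * σ ^ 2) ≤ ‖expProd γ l (pt σ 0)‖ := by
  have h1 := norm_expProd_pt_le (γ := 0) le_rfl hl h0 le_rfl hσ 0
  have h2 : expProd 0 l (pt 0 0) = 1 := by simp [expProd, pt]
  rw [h2, norm_one] at h1
  have h3 : expProd γ l (pt σ 0) = cexp (γ * -(pt σ 0) ^ 2) * expProd 0 l (pt σ 0) := by
    simp [expProd]
  rw [h3, norm_mul, norm_cexp_mul_neg_pt_sq]
  simp only [ne_eq, OfNat.ofNat_ne_zero, not_false_eq_true, zero_pow, sub_zero]
  exact le_mul_of_one_le_right (Real.exp_pos _).le h1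

/-- On the imaginary axis a positive γ would force growth at least exp(γσ²), against the upper bound
with ε = γ/2. -/
lemma exponent_eq_zero (hn : 2 ≤ n) (hγ : 0 ≤ γ) (hl : Summable l) (h0 : ∀ i, 0 ≤ l i)
    (hF : ∀ z, F (2 * n) z = F₀ n * expProd γ l z) : γ = 0 := by
  by_contra hne
  have hγ' : 0 < γ := lt_of_le_of_ne hγ (Ne.symm hne)
  have hc := F₀_pos (by omega : 1 ≤ n)
  obtain ⟨K, hK⟩ := exists_norm_F_le hn (half_pos hγ')
  have h : ∀ σ : ℝ, 0 ≤ σ → F₀ n * Real.exp (γ / 2 * σ ^ 2) ≤ K := by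
    intro σ hσ
    have h1 := hK (pt σ 0)
    rw [hF, norm_mul, norm_real, Real.norm_of_nonneg hc.le, norm_pt_zero, sq_abs] at h1
    have h2 := mul_le_mul_of_nonneg_left (exp_le_norm_expProd (γ := γ) hl h0 hσ) hc.le
    have h3 : Real.exp (γ * σ ^ 2) = Real.exp (γ / 2 * σ ^ 2) * Real.exp (γ / 2 * σ ^ 2) := by
      rw [← Real.exp_add]
      ring_nf
    rw [h3, ← mul_assoc] at h2
    exact le_of_mul_le_mul_right (h2.trans h1) (Real.exp_pos _)
  have hlim : Tendsto (fun σ : ℝ => F₀ n * Real.exp (γ / 2 * σ ^ 2)) atTop atTop :=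
    (Real.tendsto_exp_atTop.comp ((tendsto_pow_atTop two_ne_zero).const_mul_atTop
      (half_pos hγ'))).const_mul_atTop hc
  obtain ⟨σ, h1, h2⟩ := ((hlim.eventually_gt_atTop K).and (eventually_ge_atTop 0)).exists
  exact absurd (h σ h2) (not_le.mpr h1)

/-- On the imaginary axis the power series has nonnegative terms, so each one bounds F from below.
-/
lemma pow_le_norm_F (hn : 1 ≤ n) (k : ℕ) :
    ∃ b : ℝ, 0 < b ∧ ∀ σ : ℝ, b * (σ ^ 2) ^ k ≤ ‖F (2 * n) (pt σ 0)‖ := by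
  have hn0 : (0 : ℝ) < n := by exact_mod_cast hn
  have hb : ∀ k : ℕ, 0 < 1 / n * Real.Gamma ((k + 1 / 2) / n) / ((2 * k)! : ℝ) := fun k =>
    div_pos (mul_pos (by positivity) (Real.Gamma_pos_of_pos (by positivity))) (by positivity)
  refine ⟨_, hb k, fun σ => ?_⟩
  have h := hasSum_F hn (pt σ 0)
  simp only [neg_pt_zero_sq, ← ofReal_pow, ← ofReal_mul] at h
  have h2 := hasSum_re h
  simp only [ofReal_re] at h2
  refine (le_hasSum h2 k fun j _ => ?_).trans (Complex.re_le_norm _)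
  exact mul_nonneg (hb j).le (by positivity)

/-- If l i = 0, all later terms vanish and F is a polynomial of degree at most i in z². It would
then grow too slowly for the bound with exponent i + 1. -/
lemma pos_of_eq_expProd (hn : 1 ≤ n) (hanti : Antitone l) (h0 : ∀ i, 0 ≤ l i)
    (hF : ∀ z, F (2 * n) z = F₀ n * expProd 0 l z) (i : ℕ) : 0 < l i := by
  refine lt_of_le_of_ne (h0 i) fun hi => ?_
  have hz : ∀ j, i ≤ j → l j = 0 := fun j hj => le_antisymm ((hanti hj).trans hi.ge) (h0 j)
  have hc := F₀_pos hn
  obtain ⟨b, hb, h⟩ := pow_le_norm_F hn (i + 1)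
  set K := F₀ n * ∏ j ∈ Finset.range i, (1 + l j)
  have hle : ∀ σ : ℝ, 1 ≤ σ → b * σ ^ 2 ≤ K := by
    intro σ hσ
    have hσ2 : 1 ≤ σ ^ 2 := one_le_pow₀ hσ
    have h1 : expProd 0 l (pt σ 0) = ((∏ j ∈ Finset.range i, (1 + l j * σ ^ 2) : ℝ) : ℂ) := by
      rw [expProd, neg_pt_zero_sq, tprod_eq_prod (s := Finset.range i)]
      · simp
      · intro j hj
        rw [hz j (not_lt.mp fun hlt => hj (Finset.mem_range.mpr hlt))]
        simp
    have hnn : 0 ≤ ∏ j ∈ Finset.range i, (1 + l j * σ ^ 2) := Finset.prod_nonneg fun j _ => by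
      have := h0 j
      positivity
    have h2 := h σ
    rw [hF, h1, norm_mul, norm_real, norm_real, Real.norm_of_nonneg hc.le,
      Real.norm_of_nonneg hnn] at h2
    have h3 : ∏ j ∈ Finset.range i, (1 + l j * σ ^ 2)
        ≤ (∏ j ∈ Finset.range i, (1 + l j)) * (σ ^ 2) ^ i := by
      calc ∏ j ∈ Finset.range i, (1 + l j * σ ^ 2)
          ≤ ∏ j ∈ Finset.range i, ((1 + l j) * σ ^ 2) :=
            Finset.prod_le_prod (fun j _ => by have := h0 j; positivity) fun j _ => by
              rw [add_mul, one_mul]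
              linarith
        _ = _ := by rw [Finset.prod_mul_distrib, Finset.prod_const, Finset.card_range]
    have h4 := h2.trans (mul_le_mul_of_nonneg_left h3 hc.le)
    rw [pow_succ', ← mul_assoc, ← mul_assoc] at h4
    exact le_of_mul_le_mul_right h4 (by positivity)
  have hlim : Tendsto (fun σ : ℝ => b * σ ^ 2) atTop atTop :=
    (tendsto_pow_atTop two_ne_zero).const_mul_atTop hb
  obtain ⟨σ, h1, h2⟩ := ((hlim.eventually_gt_atTop K).and (eventually_ge_atTop 1)).exists
  exact absurd (hle σ h2) (not_le.mpr h1)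

lemma factor_eq {α : ℝ} (σ w : ℝ) :
    factor α σ w = ‖1 + (((α ^ 2)⁻¹ : ℝ) : ℂ) * -(pt σ w) ^ 2‖ ^ 2 := by
  rw [factor]
  congr 2
  push_cast
  ring

lemma strictMonoOn_factor {α : ℝ} (hα : 0 < α) (w : ℝ) :
    StrictMonoOn (fun σ : ℝ => factor α σ w) (Set.Ici 0) := by
  intro σ hσ τ hτ hst
  simp only [factor_eq, norm_sq_one_add_mul_neg_pt_sq]
  have hσ0 : 0 ≤ σ := hσ
  have h2 : σ ^ 2 < τ ^ 2 := pow_lt_pow_left₀ hst hσ0 two_ne_zero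
  have h4 : σ ^ 4 ≤ τ ^ 4 := pow_le_pow_left₀ hσ0 hst.le 4
  have ha : 0 < 2 * (α ^ 2)⁻¹ + 2 * (α ^ 2)⁻¹ ^ 2 * w ^ 2 := by positivity
  have := mul_lt_mul_of_pos_left h2 ha
  have := mul_le_mul_of_nonneg_left h4 (by positivity : 0 ≤ (α ^ 2)⁻¹ ^ 2)
  linarith

theorem exists_hasProd_zeros (hn : 2 ≤ n) :
    ∃ (c : ℝ) (α : ℕ → ℝ), 0 < c ∧
      Set.range α = {x : ℝ | 0 < x ∧ F (2 * n) (x : ℂ) = 0} ∧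
      (∀ z : ℂ, HasProd (fun r : ℕ => 1 - z ^ 2 / (α r : ℂ) ^ 2) (F (2 * n) z / (c : ℂ))) ∧
      (∀ σ w : ℝ, HasProd (fun r : ℕ => factor (α r) σ w)
        (‖F (2 * n) (pt σ w)‖ ^ 2 / c ^ 2)) ∧
      (∀ (r : ℕ) (w : ℝ), StrictMonoOn (fun σ : ℝ => factor (α r) σ w) (Set.Ici 0)) := by
  have hn1 : 1 ≤ n := by omega
  have hc := F₀_pos hn1
  have hc0 : (F₀ n : ℂ) ≠ 0 := ofReal_ne_zero.mpr hc.ne'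
  obtain ⟨γ, l, hγ, hanti, h0, hl, -, hF⟩ := exists_F_eq_expProd hn1
  obtain rfl := exponent_eq_zero hn hγ hl h0 hF
  have hpos := pos_of_eq_expProd hn1 hanti h0 hF
  -- The zeros are α_r = 1/√(l r), defined for every r because no l r vanishes.
  have hα : ∀ r, 0 < (Real.sqrt (l r))⁻¹ := fun r => inv_pos.mpr (Real.sqrt_pos.mpr (hpos r))
  have hα2 : ∀ r, ((Real.sqrt (l r))⁻¹ ^ 2)⁻¹ = l r := fun r => by
    rw [inv_pow, inv_inv, Real.sq_sqrt (h0 r)]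
  have hfac : ∀ (r : ℕ) (z : ℂ),
      1 - z ^ 2 / (((Real.sqrt (l r))⁻¹ : ℝ) : ℂ) ^ 2 = 1 + (l r : ℂ) * -z ^ 2 := by
    intro r z
    rw [← ofReal_pow, div_eq_mul_inv, ← ofReal_inv, hα2]
    ring
  have hprod : ∀ z : ℂ, HasProd (fun r : ℕ => 1 + (l r : ℂ) * -z ^ 2)
      (F (2 * n) z / (F₀ n : ℂ)) := by
    intro z
    rw [hF, mul_div_cancel_left₀ _ hc0]
    simpa [expProd] using hasProd_one_add hl (-z ^ 2)
  refine ⟨F₀ n, fun r => (Real.sqrt (l r))⁻¹, hc, ?_, fun z => ?_, fun σ w => ?_,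
    fun r w => strictMonoOn_factor (hα r) w⟩
  · ext x
    simp only [Set.mem_range, Set.mem_ofPred_eq, hF, mul_eq_zero, hc0, false_or,
      expProd_eq_zero_iff hl, ← hfac]
    constructor
    · rintro ⟨r, rfl⟩
      refine ⟨hα r, r, ?_⟩
      rw [div_self (pow_ne_zero 2 (ofReal_ne_zero.mpr (hα r).ne')), sub_self]
    · rintro ⟨hx, r, hr⟩
      refine ⟨r, ?_⟩
      have h1 := sub_eq_zero.mp hr
      rw [eq_div_iff (pow_ne_zero 2 (ofReal_ne_zero.mpr (hα r).ne')), one_mul] at h1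
      have h2 : (Real.sqrt (l r))⁻¹ ^ 2 = x ^ 2 := by exact_mod_cast h1
      exact (pow_left_inj₀ (hα r).le hx.le two_ne_zero).mp h2
  · simp only [hfac]
    exact hprod z
  · simp only [factor_eq, hα2]
    have h := (hprod (pt σ w)).norm
    have h2 := h.mul h
    simp only [← sq, norm_div, norm_real, div_pow, Real.norm_of_nonneg hc.le] at h2
    exact h2

end ExpFourier

theorem mainTheorem3 (n : ℕ) (hn : 1 ≤ n) :
    -- the defining integrals converge absolutely
    (∀ z : ℂ, Integrable (fun t : ℝ => cexp (-(t : ℂ) ^ (2 * n)) * cexp (I * z * t))) ∧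
    (∀ (m : ℕ) (w : ℝ), Integrable (ExpFourier.integrandA (2 * m) (2 * n) w)) ∧
    -- the power series in `σ` of the squared modulus
    (∀ σ w : ℝ, HasSum
      (fun m : ℕ => (1 / 2 : ℂ) *
        ((σ : ℂ) ^ (2 * m) / ((2 * m)! : ℂ) * ExpFourier.A (2 * m) (2 * n) w))
      ((‖ExpFourier.F (2 * n) (ExpFourier.pt σ w)‖ ^ 2 : ℝ) : ℂ)) ∧
    -- the squared modulus is strictly increasing in `σ`, from `σ = 0` onwards
    (∀ w : ℝ, StrictMonoOn
      (fun σ : ℝ => ‖ExpFourier.F (2 * n) (ExpFourier.pt σ w)‖ ^ 2) (Set.Ici 0)) ∧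
    -- for `n ≥ 2`: the product over the positive zeros, each of whose factors is increasing
    (2 ≤ n → ∃ (c : ℝ) (α : ℕ → ℝ), 0 < c ∧
      Set.range α = {x : ℝ | 0 < x ∧ ExpFourier.F (2 * n) (x : ℂ) = 0} ∧
      (∀ z : ℂ, HasProd (fun r : ℕ => 1 - z ^ 2 / (α r : ℂ) ^ 2)
        (ExpFourier.F (2 * n) z / (c : ℂ))) ∧
      (∀ σ w : ℝ, HasProd (fun r : ℕ => ExpFourier.factor (α r) σ w)
        (‖ExpFourier.F (2 * n) (ExpFourier.pt σ w)‖ ^ 2 / c ^ 2)) ∧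
      (∀ (r : ℕ) (w : ℝ),
        StrictMonoOn (fun σ : ℝ => ExpFourier.factor (α r) σ w) (Set.Ici 0))) ∧
    -- there are no zeros off the real axis
    (∀ z : ℂ, ExpFourier.F (2 * n) z = 0 → z.im = 0) ∧
    -- the angular momentum of `(R, I)` along `w = v t` at fixed `σ > 0` is positive
    (∀ σ μ v : ℝ, 0 < σ → 0 < μ → 0 < v →
      Differentiable ℝ (ExpFourier.orbit (2 * n) σ v) ∧
      ∀ t : ℝ, ∃ j : ℝ, 0 < j ∧
        ExpFourier.angularMomentum μ (ExpFourier.orbit (2 * n) σ v) t = ![0, 0, j]) :=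
  ⟨ExpFourier.integrable_integrand hn, fun m w => ExpFourier.integrable_integrandA hn (2 * m) w,
    ExpFourier.hasSum_norm_F_sq hn, ExpFourier.strictMonoOn_norm_sq_F hn,
    ExpFourier.exists_hasProd_zeros, fun _ => ExpFourier.im_eq_zero_of_F_eq_zero hn,
    fun _ _ _ => ExpFourier.angularMomentum_orbit hn⟩
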